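/- Consider circuits on qubits with all-to-all connectivity, built from the gates CNOT, $H$, $T$, $T^\dagger$ and the rotations $R_{\hat x}(\theta)=e^{-i\theta X/2}$, $R_{\hat z}(\theta)=e^{-i\theta Z/2}$ with arbitrary angles. The cost of a gate type is the number of gates of that type ($T$ and $T^\dagger$ are one type, and so are $R_{\hat x}$ and $R_{\hat z}$), and its depth is the largest number of gates of that type on a chain of gates in which consecutive ones share a qubit. For a set $C$ of qubits, a qubit $t\notin C$ and a $2\times 2$ unitary matrix $W$, let $[W]_C^t$ be the gate that applies $W$ to $t$ if all qubits of $C$ are in state $|1\rangle$, and acts as the identity otherwise. A *macro implementation* of a gate $[W]_C^t$, $W\in SU(2)$, is a circuit on the qubits $C\cup\{t\}$ that implements it exactly and is, in order of time, of the form $A_4,U_1,A_2,U_2,A_3,U_3,A_2,U_4,A_1$. Here, for some $\lambda,\theta_1,\theta_2\in\mathbb R$, the gates $A_2=R_{\hat x}(-\lambda/4)$, $A_3=R_{\hat x}(\lambda/4)$, $A_4=R_{\hat z}(\theta_2)R_{\hat x}(\theta_1)$, $A_1=A_4^\dagger A_3$ act on $t$ (eight rotations in total). For some $C_1\cup C_2=C$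 and some diagonal unitaries $\Delta_1,\Delta_2$ on $C$, the blocks $U_1,U_2,U_3,U_4$ are circuits for $\Delta_1[Z]_{C_1}^t$, $\Delta_2[Z]_{C_2}^t$, $\Delta_1^\dagger[Z]_{C_1}^t$, $\Delta_2^\dagger[Z]_{C_2}^t$, where operations that act on $C$ only may be moved from a block to a neighbouring block; that is, $U_1=V_1\Delta_1[Z]_{C_1}^t$, $U_2=V_2\Delta_2[Z]_{C_2}^tV_1^\dagger$, $U_3=V_3\Delta_1^\dagger[Z]_{C_1}^tV_2^\dagger$, $U_4=\Delta_2^\dagger[Z]_{C_2}^tV_3^\dagger$ for some unitaries $V_1,V_2,V_3$ on $C$. **Theorem.** Let $n\ge 6$ and $m\ge 1$. (1) For every $W\in SU(2)$ the gate $[W]_C^t$ with $|C|=n$ controls has a macro implementation (without ancilla) with exactly 8 rotations, CNOT cost $12n-32$ and depth at most $8n-8$, $T$ cost $16n-48$ and depth at most $8n-6$ ($8n-3$ for odd $n$), $H$ cost $8n-32$ and depth at most $4n-11$. (2) Any multi-controlled multi-target gate $\prod_{j=1}^m [W_j]_C^{t_j}$ with $|C|=n$ controls, $m$ targets and $W_1,\dots,W_m\in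 SU(2)$ can be implemented exactly and without ancilla (on the $n+m$ qubits $C\cup\{t_1,\dots,t_m\}$) with the costs and depths of any given macro implementation of a single-target gate with $n$ controls, except that the number of rotations and the CNOT cost increase by exactly $8(m-1)$ each and the CNOT depth increases by at most $8\lceil\log_2 m\rceil$. The $T$ and $H$ costs are the same, and the $T$ and $H$ depths are not larger. In particular, by (1) and (2), every such gate has a circuit with $8m$ rotations, CNOT cost $12n-32+8(m-1)$, and CNOT depth at most $8n-8+8\lceil\log_2 m\rceil$, with the $T$ and $H$ costs and depths of (1). -/

import Mathlib

open scoped Matrix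

namespace QCircuit

/-- Elementary gates on a register `Q` of qubits with all-to-all connectivity:
Clifford+T gates and the rotations about the x and z axes. -/
inductive Gate (Q : Type) : Type
  | H (q : Q)
  | T (q : Q)
  | Tdg (q : Q)
  | Rx (θ : ℝ) (q : Q)
  | Rz (θ : ℝ) (q : Q)
  | CNOT (control target : Q) (hne : control ≠ target)

/-- The types of gates that are counted separately; `T` and its inverse count as one type, and so
do the two kinds of rotations. -/
inductive Kind : Type
  | cnot
  | t
  | h
  | rot
  deriving DecidableEq

/-- A circuit: the list of its gates in order of time, the first gate of the list acts first. -/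
abbrev Circuit (Q : Type) : Type := List (Gate Q)

def Gate.kind {Q : Type} : Gate Q → Kind
  | .H _ => .h
  | .T _ => .t
  | .Tdg _ => .t
  | .Rx _ _ => .rot
  | .Rz _ _ => .rot
  | .CNOT _ _ _ => .cnot

/-- The qubits on which a gate acts. -/
def Gate.support {Q : Type} [DecidableEq Q] : Gate Q → Finset Q
  | .H q => {q}
  | .T q => {q}
  | .Tdg q => {q}
  | .Rx _ q => {q}
  | .Rz _ q => {q}
  | .CNOT c t _ => {c, t}

/-- The single-qubit Pauli and Clifford+T matrices. -/
def pauliX : Matrix (Fin 2) (Fin 2) ℂ := !![0, 1; 1, 0]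

def pauliZ : Matrix (Fin 2) (Fin 2) ℂ := !![1, 0; 0, -1]

noncomputable def hadamard : Matrix (Fin 2) (Fin 2) ℂ :=
  ((Real.sqrt 2 : ℝ) : ℂ)⁻¹ • !![1, 1; 1, -1]

/-- The phase gate `P(φ)`; `T = P(π/4)`. -/
noncomputable def phase (φ : ℝ) : Matrix (Fin 2) (Fin 2) ℂ :=
  !![1, 0; 0, Complex.exp (Complex.I * φ)]

/-- `Rx θ = exp (-i θ X / 2)`. -/
noncomputable def rotX (θ : ℝ) : Matrix (Fin 2) (Fin 2) ℂ :=
  !![(Real.cos (θ / 2) : ℂ), -Complex.I * (Real.sin (θ / 2) : ℂ);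
     -Complex.I * (Real.sin (θ / 2) : ℂ), (Real.cos (θ / 2) : ℂ)]

/-- `Rz θ = exp (-i θ Z / 2)`. -/
noncomputable def rotZ (θ : ℝ) : Matrix (Fin 2) (Fin 2) ℂ :=
  !![Complex.exp (-Complex.I * (θ / 2 : ℝ)), 0; 0, Complex.exp (Complex.I * (θ / 2 : ℝ))]

section Semantics

variable {Q : Type} [Fintype Q] [DecidableEq Q]

/-- Operators on a register, as matrices in the computational basis; a basis state is an
assignment of a bit to every qubit. -/
abbrev Op (Q : Type) : Type := Matrix (Q → Fin 2) (Q → Fin 2) ℂ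

/-- The matrix `M` applied to qubit `t`, controlled on all qubits of `C` being in state 1. For
`C = ∅` this is `M` applied to `t`, with the identity on all other qubits. -/
def controlled (C : Finset Q) (t : Q) (M : Matrix (Fin 2) (Fin 2) ℂ) : Op Q :=
  fun x y =>
    if ∀ q, q ≠ t → x q = y q then
      if ∀ q ∈ C, y q = 1 then M (x t) (y t) else (1 : Matrix (Fin 2) (Fin 2) ℂ) (x t) (y t)
    else 0

noncomputable def Gate.toOp : Gate Q → Op Q
  | .H q => controlled ∅ q hadamard
  | .T q => controlled ∅ q (phase (Real.pi / 4))
  | .Tdg q => controlled ∅ q (phase (-(Real.pi / 4)))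
  | .Rx θ q => controlled ∅ q (rotX θ)
  | .Rz θ q => controlled ∅ q (rotZ θ)
  | .CNOT c t _ => controlled {c} t pauliX

/-- The operator of a circuit. -/
noncomputable def eval : Circuit Q → Op Q
  | [] => 1
  | g :: c => eval c * g.toOp

/-- The number of gates of a given type. -/
def count (k : Kind) (c : Circuit Q) : ℕ := c.countP (fun g => g.kind = k)

/-- One step in the computation of the depth: `lev q` is the largest number of gates of type `k`
on a chain of successive gates that ends on qubit `q`. -/
def stepLevel (k : Kind) (lev : Q → ℕ) (g : Gate Q) : Q → ℕ :=
  fun q => if q ∈ g.support then g.support.sup lev + (if g.kind = k then 1 else 0) else lev q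

/-- The depth of a circuit with respect to the gates of type `k`: the largest number of gates of
type `k` on a chain of gates in which consecutive ones share a qubit. This is the least
number of parallel time slots with gates of type `k`. -/
def depth (k : Kind) (c : Circuit Q) : ℕ :=
  Finset.univ.sup (c.foldl (stepLevel k) (fun _ => 0))

end Semantics

/-- The multi-controlled multi-target gate `∏ⱼ [Wⱼ]` with `n` controls (left summand) and `m`
targets (right summand): if all the controls are in state 1, then `W j` is applied to the `j`-th
target for every `j`. The factors commute. -/
def multiControlledMultiTarget (n m : ℕ) (W : Fin m → Matrix (Fin 2) (Fin 2) ℂ) :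
    Op (Fin n ⊕ Fin m) :=
  (List.ofFn fun j : Fin m =>
    controlled (Finset.univ.map Function.Embedding.inl) (Sum.inr j) (W j)).prod

/-- The operator `V` on the `n` controls, with the identity on the single target. -/
def onControls {n : ℕ} (V : Op (Fin n)) : Op (Fin n ⊕ Fin 1) :=
  fun x y =>
    if x (Sum.inr 0) = y (Sum.inr 0) then V (fun i => x (Sum.inl i)) (fun i => y (Sum.inl i)) else 0

/-- Multi-controlled `Z` on the single target, controlled by a subset `C` of the controls. -/
def mcz {n : ℕ} (C : Finset (Fin n)) : Op (Fin n ⊕ Fin 1) :=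
  controlled (C.map Function.Embedding.inl) (Sum.inr 0) pauliZ

/-- The macro structure of a single-target circuit: the single-qubit gates `A₄`, `A₂`, `A₃`, `A₂`,
`A₁` on the target, in this order of time, separated by the four large blocks `U₁, …, U₄`, where
`A₂ = Rx(-lam/4)`, `A₃ = Rx(lam/4)`, `A₄ = Rz(θ₂) Rx(θ₁)` and `A₁ = A₄† A₃`. -/
noncomputable def macroCircuit {n : ℕ} (U₁ U₂ U₃ U₄ : Circuit (Fin n ⊕ Fin 1))
    (lam θ₁ θ₂ : ℝ) : Circuit (Fin n ⊕ Fin 1) :=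
  [.Rx θ₁ (Sum.inr 0), .Rz θ₂ (Sum.inr 0)] ++ U₁ ++
  [.Rx (-(lam / 4)) (Sum.inr 0)] ++ U₂ ++
  [.Rx (lam / 4) (Sum.inr 0)] ++ U₃ ++
  [.Rx (-(lam / 4)) (Sum.inr 0)] ++ U₄ ++
  [.Rx (lam / 4) (Sum.inr 0), .Rz (-θ₂) (Sum.inr 0), .Rx (-θ₁) (Sum.inr 0)]

/-- `K` implements the `n`-controlled single-target gate `W` through the macro structure: with
`C₁ ∪ C₂` the set of all controls, the four blocks implement `Δ₁ · MCZ(C₁)`, `Δ₂ · MCZ(C₂)`,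
`Δ₁† · MCZ(C₁)`, `Δ₂† · MCZ(C₂)`, where `Δ₁`, `Δ₂` are relative phases (diagonal unitaries) on
the controls. Operations on the controls alone commute with the gates `Aᵢ` on the target, so they
may be moved from a block to the next one and be simplified there; the unitaries `V₁, V₂, V₃` are
what has been moved across the three inner gates `A₂, A₃, A₂` (they are 1 if nothing is moved). -/
def IsMacroImplementation {n : ℕ} (K : Circuit (Fin n ⊕ Fin 1))
    (W : Matrix (Fin 2) (Fin 2) ℂ) : Prop :=
  ∃ (C₁ C₂ : Finset (Fin n)) (δ₁ δ₂ : (Fin n → Fin 2) → ℂ) (V₁ V₂ V₃ : Op (Fin n))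
    (U₁ U₂ U₃ U₄ : Circuit (Fin n ⊕ Fin 1)) (lam θ₁ θ₂ : ℝ),
    C₁ ∪ C₂ = Finset.univ ∧
    (∀ x, ‖δ₁ x‖ = 1) ∧ (∀ x, ‖δ₂ x‖ = 1) ∧
    V₁ ∈ Matrix.unitaryGroup (Fin n → Fin 2) ℂ ∧
    V₂ ∈ Matrix.unitaryGroup (Fin n → Fin 2) ℂ ∧
    V₃ ∈ Matrix.unitaryGroup (Fin n → Fin 2) ℂ ∧
    eval U₁ = onControls V₁ * (onControls (Matrix.diagonal δ₁) * mcz C₁) ∧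
    eval U₂ = onControls V₂ * (onControls (Matrix.diagonal δ₂) * mcz C₂) * onControls V₁ᴴ ∧
    eval U₃ = onControls V₃ * (onControls (Matrix.diagonal δ₁)ᴴ * mcz C₁) * onControls V₂ᴴ ∧
    eval U₄ = onControls (Matrix.diagonal δ₂)ᴴ * mcz C₂ * onControls V₃ᴴ ∧
    K = macroCircuit U₁ U₂ U₃ U₄ lam θ₁ θ₂ ∧
    eval K = multiControlledMultiTarget n 1 (fun _ => W)

end QCircuit

/-!
The single-target circuit rests on a relative-phase version of the multi-controlled `Z`. A ladder of
Margolus gates with dirty ancillas computes a doubly controlled `Z` (up to phases) at its top, and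
the target sits at its bottom, as a control of the outermost Margolus gates. Each Margolus gate is
self-inverse and permutes the basis states up to phases, so conjugation by it maps diagonal
operators to diagonal operators (`IsLocal.conj_diagonal`). The whole ladder is therefore diagonal,
and the unwanted sign that comes from the dirty ancillas does not involve the target, so that it is
a relative phase on the controls (`eval_ladder`). Inverting the central gate alone conjugates this
phase. The controls are split into two halves, and each half lends its qubits as ancillas to the
other one. Nothing has to be moved between the blocks.

In the macro structure the relative phases cancel, and the rotations add up to the full angle
exactly if both blocks are active, since `Z Rx(a) Z = Rx(-a)` (`rotation_identity`,
`macro_identity`). Every element of `SU(2)` is conjugate to an `Rx` by an `Rz` and an `Rx`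
(`exists_euler`, which is spherical coordinates). The gate counts of a ladder are exact. For the
depth, one follows the levels of all the qubits: the outermost control and ancilla are the only
qubits on which a block ends late, and for consecutive blocks these pairs are disjoint
(`levels_ladder_of_late`), so that the blocks overlap.

For several targets, each block is conjugated by a binary tree of CNOT gates which adds the bits of
all targets to the first one. This turns the `Z` on the first target into a `Z` on every target
(`fanIn_conj`), and commutes with operators on the controls. Every rotation is replaced by a layer
of rotations, one for each target, and the cancellation in `macro_identity` takes place for all
targets at once. The eight trees account for the additional CNOT gates, and a comparison of levels
(`Simulates`) shows that each of them adds at most `⌈log₂ m⌉` to the CNOT depth and nothing to the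
other depths.
-/

namespace QCircuit

/-! ### Operators that act on a single qubit -/

section Blocks

variable {Q : Type} [DecidableEq Q]

/-- The CNOT gate, or no gate at all if control and target coincide. -/
def cx (c t : Q) : Circuit Q := if h : c ≠ t then [.CNOT c t h] else []

theorem cx_of_ne {c t : Q} (h : c ≠ t) : cx c t = [.CNOT c t h] := dif_pos h

theorem agree_off_iff (w : Q) (x y : Q → Fin 2) :
    (∀ q, q ≠ w → x q = y q) ↔ x = Function.update y w (x w) := by
  constructor
  · intro h
    funext q
    by_cases hq : q = w
    · subst hq; simp
    · simp [hq, h q hq]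
  · intro h q hq
    rw [h]; simp [hq]

/-- The basis state `x`, with the bit of `a` flipped if `P x` holds. -/
def flipIf (P : (Q → Fin 2) → Prop) [DecidablePred P] (a : Q) (x : Q → Fin 2) : Q → Fin 2 :=
  if P x then Function.update x a (1 - x a) else x

theorem flipIf_of_ne (P : (Q → Fin 2) → Prop) [DecidablePred P] {a q : Q} (h : q ≠ a)
    (x : Q → Fin 2) : flipIf P a x q = x q := by
  unfold flipIf; split_ifs <;> simp [h]

theorem flipIf_self (P : (Q → Fin 2) → Prop) [DecidablePred P] (a : Q) (x : Q → Fin 2) :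
    flipIf P a x a = if P x then 1 - x a else x a := by
  unfold flipIf; split_ifs <;> simp

variable [Fintype Q]

/-- The operator that applies to qubit `w` the matrix `g y`, where `y` is the basis state that it
acts on. -/
def localOp (w : Q) (g : (Q → Fin 2) → Matrix (Fin 2) (Fin 2) ℂ) : Op Q :=
  fun x y => if ∀ q, q ≠ w → x q = y q then g y (x w) (y w) else 0

/-- `E` acts on the qubit `w` only, by the matrix `g y`, which does not depend on the bit of `w`. -/
def IsLocal (w : Q) (E : Op Q) (g : (Q → Fin 2) → Matrix (Fin 2) (Fin 2) ℂ) : Prop :=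
  E = localOp w g ∧ ∀ y b, g (Function.update y w b) = g y

theorem localOp_mul (w : Q) (g h : (Q → Fin 2) → Matrix (Fin 2) (Fin 2) ℂ)
    (hg : ∀ y b, g (Function.update y w b) = g y) :
    localOp w g * localOp w h = localOp w (fun y => g y * h y) := by
  funext x y
  rw [Matrix.mul_apply]
  rw [← Fintype.sum_of_injective (fun b : Fin 2 => Function.update y w b)
    (Function.update_injective y w)
    (fun b => localOp w g x (Function.update y w b) * localOp w h (Function.update y w b) y)]
  · have h1 : ∀ b, (∀ q, q ≠ w → x q = Function.update y w b q) ↔ ∀ q, q ≠ w → x q = y q := by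
      intro b
      refine forall_congr' fun q => forall_congr' fun hq => ?_
      simp [hq]
    have h2 : ∀ b, ∀ q, q ≠ w → Function.update y w b q = y q := by
      intro b q hq; simp [hq]
    simp only [localOp, h1, hg, Function.update_self]
    by_cases hx : ∀ q, q ≠ w → x q = y q
    · simp only [if_pos hx, if_pos (h2 _), Matrix.mul_apply]
    · simp [if_neg hx]
  · intro z hz
    have : ¬ ∀ q, q ≠ w → z q = y q := by
      intro h
      exact hz ⟨z w, ((agree_off_iff w z y).1 h).symm⟩
    simp [localOp, if_neg this]
  · intro b; rfl

theorem IsLocal.mul {w : Q} {E F : Op Q} {g h : (Q → Fin 2) → Matrix (Fin 2) (Fin 2) ℂ}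
    (hE : IsLocal w E g) (hF : IsLocal w F h) : IsLocal w (E * F) (fun y => g y * h y) := by
  refine ⟨?_, fun y b => by simp only [hE.2, hF.2]⟩
  rw [hE.1, hF.1, localOp_mul _ _ _ hE.2]

theorem isLocal_one (w : Q) : IsLocal w (1 : Op Q) (fun _ => 1) := by
  refine ⟨?_, fun _ _ => rfl⟩
  funext x y
  simp only [localOp, Matrix.one_apply]
  by_cases h : ∀ q, q ≠ w → x q = y q
  · rw [if_pos h]
    refine if_congr ⟨fun e => by rw [e], fun e => ?_⟩ rfl rfl
    rw [(agree_off_iff w x y).1 h, e, Function.update_eq_self]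
  · rw [if_neg h, if_neg]
    rintro rfl
    exact h fun _ _ => rfl

theorem isLocal_controlled (C : Finset Q) (w : Q) (hw : w ∉ C) (M : Matrix (Fin 2) (Fin 2) ℂ) :
    IsLocal w (controlled C w M) (fun y => if ∀ q ∈ C, y q = 1 then M else 1) := by
  refine ⟨?_, fun y b => ?_⟩
  · funext x y
    simp only [controlled, localOp]
    split_ifs <;> rfl
  · refine if_congr (forall_congr' fun q => forall_congr' fun hq => ?_) rfl rfl
    have : q ≠ w := fun e => hw (e ▸ hq)
    simp [this]

theorem isLocal_single (w : Q) (M : Matrix (Fin 2) (Fin 2) ℂ) :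
    IsLocal w (controlled ∅ w M) (fun _ => M) := by
  simpa using isLocal_controlled ∅ w (by simp) M

theorem isLocal_cnot (c w : Q) (h : c ≠ w) :
    IsLocal w (controlled {c} w pauliX) (fun y => if y c = 1 then pauliX else 1) := by
  simpa using isLocal_controlled {c} w (by simpa using h.symm) pauliX

theorem IsLocal.congr {w : Q} {E : Op Q} {g h : (Q → Fin 2) → Matrix (Fin 2) (Fin 2) ℂ}
    (hE : IsLocal w E g) (e : ∀ y, g y = h y) : IsLocal w E h := by
  rwa [← funext e]

theorem eval_append (c d : Circuit Q) : eval (c ++ d) = eval d * eval c := by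
  induction c with
  | nil => simp [eval]
  | cons g c ih => simp [eval, ih, Matrix.mul_assoc]

/-- The relative phase Toffoli gate of Margolus with controls `s`, `c` and target `a`. The control
`s` is used by the central CNOT only. -/
def margolus (s c a : Q) : Circuit Q :=
  [.H a, .T a] ++ cx c a ++ [.Tdg a] ++ cx s a ++ [.T a] ++ cx c a ++ [.Tdg a, .H a]

/-- `T` or its inverse. -/
def tGate (b : Bool) (q : Q) : Gate Q := if b then .T q else .Tdg q

/-- A doubly controlled `Z` on `s`, up to a phase that depends on the two controls; for
`b = false` the inverse circuit of the one for `b = true`. -/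
def cczCore (b : Bool) (s c c' : Q) : Circuit Q :=
  [tGate b s] ++ cx c s ++ [tGate (!b) s] ++ cx c' s ++ [tGate b s] ++ cx c s ++
    [tGate (!b) s] ++ cx c' s

/-- The matrix `Y`. -/
noncomputable def pauliY : Matrix (Fin 2) (Fin 2) ℂ := !![0, -Complex.I; Complex.I, 0]

theorem exp_quarter_mul :
    Complex.exp (Complex.I * ((Real.pi / 4 : ℝ) : ℂ)) *
      Complex.exp (Complex.I * ((-(Real.pi / 4) : ℝ) : ℂ)) = 1 := by
  rw [← Complex.exp_add, ← Complex.exp_zero]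
  congr 1; push_cast; ring

theorem exp_quarter_sq :
    Complex.exp (Complex.I * ((Real.pi / 4 : ℝ) : ℂ)) ^ 2 = Complex.I := by
  have h : ((2 : ℕ) : ℂ) * (Complex.I * ((Real.pi / 4 : ℝ) : ℂ)) = Real.pi / 2 * Complex.I := by
    push_cast; ring
  rw [← Complex.exp_nat_mul, h, Complex.exp_pi_div_two_mul_I]

theorem exp_neg_quarter_sq :
    Complex.exp (Complex.I * ((-(Real.pi / 4) : ℝ) : ℂ)) ^ 2 = -Complex.I := by
  have h1 := exp_quarter_mul
  have h2 := exp_quarter_sq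
  generalize Complex.exp (Complex.I * ((Real.pi / 4 : ℝ) : ℂ)) = u at *
  generalize Complex.exp (Complex.I * ((-(Real.pi / 4) : ℝ) : ℂ)) = v at *
  linear_combination (-Complex.I) * (u * v + 1) * h1 + Complex.I * v ^ 2 * h2 +
    v ^ 2 * Complex.I_mul_I

theorem phase_inv_mul : phase (-(Real.pi / 4)) * phase (Real.pi / 4) = 1 := by
  have h := exp_quarter_mul
  ext i j
  fin_cases i <;> fin_cases j <;>
    simp [phase, Matrix.mul_apply, Fin.sum_univ_two] at h ⊢
  rw [mul_comm]; exact h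

theorem phase_mul_inv : phase (Real.pi / 4) * phase (-(Real.pi / 4)) = 1 :=
  mul_eq_one_comm.1 phase_inv_mul

theorem pauliX_mul_self : pauliX * pauliX = 1 := by
  ext i j; fin_cases i <;> fin_cases j <;> simp [pauliX, Matrix.mul_apply, Fin.sum_univ_two]

theorem pauliY_mul_self : pauliY * pauliY = 1 := by
  ext i j; fin_cases i <;> fin_cases j <;> simp [pauliY, Matrix.mul_apply, Fin.sum_univ_two]

theorem pauliZ_mul_self : pauliZ * pauliZ = 1 := by
  ext i j; fin_cases i <;> fin_cases j <;> simp [pauliZ, Matrix.mul_apply, Fin.sum_univ_two]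

theorem sqrt_two_inv_sq : (((Real.sqrt 2 : ℝ) : ℂ)⁻¹) * (((Real.sqrt 2 : ℝ) : ℂ)⁻¹) = 1 / 2 := by
  rw [← mul_inv, ← Complex.ofReal_mul, Real.mul_self_sqrt (by norm_num)]; norm_num

theorem hadamard_conj (a b c d : ℂ) :
    hadamard * !![a, b; c, d] * hadamard =
      (1 / 2 : ℂ) • !![a + b + c + d, a - b + c - d; a + b - c - d, a - b - c + d] := by
  rw [← sqrt_two_inv_sq]
  ext i j
  fin_cases i <;> fin_cases j <;>
    simp [hadamard, Matrix.mul_apply, Fin.sum_univ_two] <;> ring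

theorem hadamard_mul_self : hadamard * hadamard = 1 := by
  have := hadamard_conj 1 0 0 1
  rw [← Matrix.one_fin_two, Matrix.mul_one] at this
  rw [this]
  ext i j
  fin_cases i <;> fin_cases j <;> simp <;> norm_num

theorem hadamard_pauliX : hadamard * pauliX * hadamard = pauliZ := by
  rw [pauliX, hadamard_conj]
  ext i j
  fin_cases i <;> fin_cases j <;> simp [pauliZ] <;> norm_num

/-- The matrix on the target of the Margolus gate if both controls are in state 1. -/
theorem margolus_center :
    hadamard * (phase (-(Real.pi / 4)) * pauliX * phase (Real.pi / 4) * pauliX *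
      phase (-(Real.pi / 4)) * pauliX * phase (Real.pi / 4)) * hadamard = pauliY := by
  have h1 := exp_quarter_sq
  have h2 := exp_neg_quarter_sq
  have : phase (-(Real.pi / 4)) * pauliX * phase (Real.pi / 4) * pauliX *
      phase (-(Real.pi / 4)) * pauliX * phase (Real.pi / 4) = !![0, Complex.I; -Complex.I, 0] := by
    ext i j
    fin_cases i <;> fin_cases j <;>
      simp [phase, pauliX, Matrix.mul_apply, Fin.sum_univ_two] at h1 h2 ⊢
    · linear_combination h1
    · linear_combination h2
  rw [this, hadamard_conj]
  ext i j
  fin_cases i <;> fin_cases j <;> simp [pauliY] <;> ring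

/-- The matrix on the target of `cczCore true` if both controls are in state 1. -/
theorem ccz_center :
    pauliX * phase (-(Real.pi / 4)) * pauliX * phase (Real.pi / 4) * pauliX *
      phase (-(Real.pi / 4)) * pauliX * phase (Real.pi / 4) = (-Complex.I) • pauliZ := by
  have h1 := exp_quarter_sq
  have h2 := exp_neg_quarter_sq
  ext i j
  fin_cases i <;> fin_cases j <;>
    simp [phase, pauliX, pauliZ, Matrix.mul_apply, Fin.sum_univ_two] at h1 h2 ⊢
  · linear_combination h2
  · linear_combination h1

/-- The matrix on the target of `cczCore false` if both controls are in state 1. -/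
theorem ccz_center_inv :
    pauliX * phase (Real.pi / 4) * pauliX * phase (-(Real.pi / 4)) * pauliX *
      phase (Real.pi / 4) * pauliX * phase (-(Real.pi / 4)) = Complex.I • pauliZ := by
  have h1 := exp_quarter_sq
  have h2 := exp_neg_quarter_sq
  ext i j
  fin_cases i <;> fin_cases j <;>
    simp [phase, pauliX, pauliZ, Matrix.mul_apply, Fin.sum_univ_two] at h1 h2 ⊢
  · linear_combination h1
  · linear_combination h2

/-- The matrix that the Margolus gate applies to its target. -/
noncomputable def margolusMatrix (u v : Fin 2) : Matrix (Fin 2) (Fin 2) ℂ :=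
  if u = 1 then (if v = 1 then pauliY else pauliZ) else 1

theorem isLocal_margolus (s c a : Q) (hs : s ≠ a) (hc : c ≠ a) :
    IsLocal a (eval (margolus s c a)) (fun y => margolusMatrix (y s) (y c)) := by
  have hH := isLocal_single a hadamard
  have hT := isLocal_single a (phase (Real.pi / 4))
  have hTd := isLocal_single a (phase (-(Real.pi / 4)))
  have hcc := isLocal_cnot c a hc
  have hss := isLocal_cnot s a hs
  have key := ((((((((hH.mul hTd).mul hcc).mul hT).mul hss).mul hTd).mul hcc).mul hT).mul hH)
  have e : eval (margolus s c a) = controlled ∅ a hadamard *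
      controlled ∅ a (phase (-(Real.pi / 4))) * controlled {c} a pauliX *
      controlled ∅ a (phase (Real.pi / 4)) * controlled {s} a pauliX *
      controlled ∅ a (phase (-(Real.pi / 4))) * controlled {c} a pauliX *
      controlled ∅ a (phase (Real.pi / 4)) * controlled ∅ a hadamard := by
    simp [margolus, cx_of_ne hs, cx_of_ne hc, eval, Gate.toOp]
  rw [e]
  refine key.congr fun y => ?_
  -- if one of the controls is in state 0, then the `T` gates cancel with their inverses
  have m := margolus_center
  have hx := hadamard_pauliX
  have hh := hadamard_mul_self
  simp only [Matrix.mul_assoc] at m hx ⊢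
  have k1 : ∀ A, phase (-(Real.pi / 4)) * (phase (Real.pi / 4) * A) = A := fun A => by
    rw [← Matrix.mul_assoc, phase_inv_mul, Matrix.one_mul]
  have k2 : ∀ A, phase (Real.pi / 4) * (phase (-(Real.pi / 4)) * A) = A := fun A => by
    rw [← Matrix.mul_assoc, phase_mul_inv, Matrix.one_mul]
  have k3 : ∀ A, pauliX * (pauliX * A) = A := fun A => by
    rw [← Matrix.mul_assoc, pauliX_mul_self, Matrix.one_mul]
  unfold margolusMatrix
  split_ifs <;> simp only [Matrix.one_mul, k1, k2, k3, m, hx, hh]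

/-- The phase that accompanies the doubly controlled `Z` of `cczCore`. -/
noncomputable def corePhase (b : Bool) (u v : Fin 2) : ℂ :=
  if u = 1 ∧ v = 1 then (if b then -Complex.I else Complex.I) else 1

theorem isLocal_cczCore (b : Bool) (s c c' : Q) (hc : c ≠ s) (hc' : c' ≠ s) :
    IsLocal s (eval (cczCore b s c c')) (fun y => corePhase b (y c) (y c') •
      (if y c = 1 ∧ y c' = 1 then pauliZ else 1)) := by
  have hT := isLocal_single s (phase (Real.pi / 4))
  have hTd := isLocal_single s (phase (-(Real.pi / 4)))
  have h1 := isLocal_cnot c s hc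
  have h2 := isLocal_cnot c' s hc'
  have m := ccz_center
  have m' := ccz_center_inv
  have k1 : ∀ A, phase (-(Real.pi / 4)) * (phase (Real.pi / 4) * A) = A := fun A => by
    rw [← Matrix.mul_assoc, phase_inv_mul, Matrix.one_mul]
  have k2 : ∀ A, phase (Real.pi / 4) * (phase (-(Real.pi / 4)) * A) = A := fun A => by
    rw [← Matrix.mul_assoc, phase_mul_inv, Matrix.one_mul]
  have k3 : ∀ A, pauliX * (pauliX * A) = A := fun A => by
    rw [← Matrix.mul_assoc, pauliX_mul_self, Matrix.one_mul]
  simp only [Matrix.mul_assoc] at m m'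
  cases b
  · have key := (((((((h2.mul hT).mul h1).mul hTd).mul h2).mul hT).mul h1).mul hTd)
    have e : eval (cczCore false s c c') = controlled {c'} s pauliX *
        controlled ∅ s (phase (Real.pi / 4)) * controlled {c} s pauliX *
        controlled ∅ s (phase (-(Real.pi / 4))) * controlled {c'} s pauliX *
        controlled ∅ s (phase (Real.pi / 4)) * controlled {c} s pauliX *
        controlled ∅ s (phase (-(Real.pi / 4))) := by
      simp [cczCore, tGate, cx_of_ne hc, cx_of_ne hc', eval, Gate.toOp]
    rw [e]
    refine key.congr fun y => ?_
    simp only [Matrix.mul_assoc, corePhase]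
    by_cases e1 : y c = 1 <;> by_cases e2 : y c' = 1 <;>
      simp [e1, e2, k1, k2, k3, phase_mul_inv, pauliX_mul_self, m']
  · have key := (((((((h2.mul hTd).mul h1).mul hT).mul h2).mul hTd).mul h1).mul hT)
    have e : eval (cczCore true s c c') = controlled {c'} s pauliX *
        controlled ∅ s (phase (-(Real.pi / 4))) * controlled {c} s pauliX *
        controlled ∅ s (phase (Real.pi / 4)) * controlled {c'} s pauliX *
        controlled ∅ s (phase (-(Real.pi / 4))) * controlled {c} s pauliX *
        controlled ∅ s (phase (Real.pi / 4)) := by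
      simp [cczCore, tGate, cx_of_ne hc, cx_of_ne hc', eval, Gate.toOp]
    rw [e]
    refine key.congr fun y => ?_
    simp only [Matrix.mul_assoc, corePhase]
    by_cases e1 : y c = 1 <;> by_cases e2 : y c' = 1 <;>
      simp [e1, e2, k1, k2, k3, phase_inv_mul, pauliX_mul_self, m]

end Blocks

/-! ### Ladders of Margolus gates -/

section Ladder

variable {Q : Type}

/-- The conditions on the qubits of a ladder that are inherited by the inner ladder. -/
theorem ladder_nodup_cons {s c a : Q} {cs as : List Q}
    (hnd : (s :: (c :: cs ++ a :: as)).Nodup) :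
    (a :: (cs ++ as)).Nodup ∧ s ≠ a ∧ c ≠ a ∧ s ≠ c ∧ s ∉ cs ++ as ∧ c ∉ cs ++ as := by
  simp only [List.cons_append, List.nodup_cons, List.mem_cons, List.mem_append, not_or,
    List.nodup_append] at hnd ⊢
  obtain ⟨⟨h1, h2, h3, h4⟩, ⟨h5, h6, h7⟩, h8, ⟨h9, h10⟩, h11⟩ := hnd
  refine ⟨⟨⟨fun h => h11 a h a (Or.inl rfl) rfl, h9⟩, h8, h10, ?_⟩, h3, h6, h1, ⟨h2, h4⟩, h5, h7⟩
  intro p hp q hq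
  exact h11 p hp q (Or.inr hq)

theorem ladder_nodup_pair {s c c' : Q} (hnd : (s :: ([c, c'] ++ [])).Nodup) :
    c ≠ s ∧ c' ≠ s ∧ c ≠ c' := by
  simp only [List.append_nil, List.nodup_cons, List.mem_cons, List.not_mem_nil, or_false,
    not_or] at hnd
  exact ⟨fun e => hnd.1.1 e.symm, fun e => hnd.1.2 e.symm, hnd.2.1⟩

variable [Fintype Q] [DecidableEq Q]

theorem IsLocal.mul_self {w : Q} {E : Op Q} {g : (Q → Fin 2) → Matrix (Fin 2) (Fin 2) ℂ}
    (hE : IsLocal w E g) (h : ∀ y, g y * g y = 1) : E * E = 1 := by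
  rw [((hE.mul hE).congr h).1, (isLocal_one w).1]

/-- A self-inverse operator that permutes the basis states up to phases maps diagonal operators to
diagonal operators under conjugation. -/
theorem IsLocal.conj_diagonal {a : Q} {E : Op Q} {g : (Q → Fin 2) → Matrix (Fin 2) (Fin 2) ℂ}
    (hE : IsLocal a E g) (hg : ∀ y, g y * g y = 1) (P : (Q → Fin 2) → Prop) [DecidablePred P]
    (hP : ∀ y i j, g y i j ≠ 0 → i = if P y then 1 - j else j) (f : (Q → Fin 2) → ℂ) :
    E * Matrix.diagonal f * E = Matrix.diagonal (fun x => f (flipIf P a x)) := by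
  have h1 : Matrix.diagonal f * E = E * Matrix.diagonal (fun x => f (flipIf P a x)) := by
    funext x y
    rw [Matrix.diagonal_mul, Matrix.mul_diagonal, mul_comm]
    by_cases h0 : E x y = 0
    · simp [h0]
    · have hx : x = flipIf P a y := by
        rw [hE.1, localOp] at h0
        simp only [ne_eq, ite_eq_right_iff, not_forall] at h0
        obtain ⟨hag, hne⟩ := h0
        rw [(agree_off_iff a x y).1 hag, hP _ _ _ hne, flipIf]
        split_ifs <;> simp
      rw [← hx]
  rw [Matrix.mul_assoc, h1, ← Matrix.mul_assoc, hE.mul_self hg, Matrix.one_mul]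

theorem margolusMatrix_mul_self (u v : Fin 2) : margolusMatrix u v * margolusMatrix u v = 1 := by
  unfold margolusMatrix
  split_ifs
  · exact pauliY_mul_self
  · exact pauliZ_mul_self
  · exact Matrix.one_mul 1

theorem margolusMatrix_ne_zero {u v i j : Fin 2} (h : margolusMatrix u v i j ≠ 0) :
    i = if u = 1 ∧ v = 1 then 1 - j else j := by
  unfold margolusMatrix at h
  by_cases h1 : u = 1 <;> by_cases h2 : v = 1 <;> simp only [h1, h2, if_true, if_false] at h ⊢ <;>
    fin_cases i <;> fin_cases j <;> simp [pauliY, pauliZ] at h ⊢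

theorem margolus_conj_diagonal (s c a : Q) (hs : s ≠ a) (hc : c ≠ a) (f : (Q → Fin 2) → ℂ) :
    eval (margolus s c a) * Matrix.diagonal f * eval (margolus s c a) =
      Matrix.diagonal (fun x => f (flipIf (fun x => x s = 1 ∧ x c = 1) a x)) :=
  (isLocal_margolus s c a hs hc).conj_diagonal (fun _ => margolusMatrix_mul_self _ _) _
    (fun _ _ _ => margolusMatrix_ne_zero) f

theorem cx_conj_diagonal (b a : Q) (h : b ≠ a) (f : (Q → Fin 2) → ℂ) :
    eval (cx b a) * Matrix.diagonal f * eval (cx b a) =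
      Matrix.diagonal (fun x => f (flipIf (fun x => x b = 1) a x)) := by
  have e : eval (cx b a) = controlled {b} a pauliX := by simp [cx_of_ne h, eval, Gate.toOp]
  rw [e]
  refine (isLocal_cnot b a h).conj_diagonal (fun y => ?_) _ (fun y i j hne => ?_) f
  · split_ifs
    · exact pauliX_mul_self
    · exact Matrix.one_mul 1
  · by_cases hb : y b = 1 <;> simp only [hb, if_true, if_false] at hne ⊢ <;>
      fin_cases i <;> fin_cases j <;> simp [pauliX] at hne ⊢

/-- The circuit that applies, up to a relative phase, a `Z` on `s` controlled by all qubits of `cs`.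
The qubits of `as` serve as dirty ancillas; there are two fewer of them than controls. -/
def ladder (b : Bool) : Q → List Q → List Q → Circuit Q
  | s, c :: cs, a :: as => margolus s c a ++ ladder b a cs as ++ margolus s c a
  | s, [c, c'], [] => cczCore b s c c'
  | _, _, _ => []

theorem controlled_pauliZ (C : Finset Q) (s : Q) :
    controlled C s pauliZ =
      Matrix.diagonal (fun x => if x s = 1 ∧ ∀ c ∈ C, x c = 1 then (-1 : ℂ) else 1) := by
  funext x y
  rw [Matrix.diagonal_apply]
  simp only [controlled]
  by_cases h : x = y
  · subst h
    have : x s = 0 ∨ x s = 1 := by omega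
    rcases this with h | h <;> simp [h, pauliZ]
  · rw [if_neg h]
    by_cases h' : ∀ q, q ≠ s → x q = y q
    · have hne : x s ≠ y s := fun e => h (by
        rw [(agree_off_iff s x y).1 h', e, Function.update_eq_self])
      rw [if_pos h']
      generalize x s = u at *
      generalize y s = v at *
      split_ifs <;> fin_cases u <;> fin_cases v <;> simp [pauliZ] at hne ⊢
    · rw [if_neg h']

/-- The ladder is a multiply controlled `Z` times a relative phase that does not involve the
bottom qubit `s`; replacing the central gate by its inverse conjugates the relative phase. -/
theorem eval_ladder (as : List Q) : ∀ (s : Q) (cs : List Q), cs.length = as.length + 2 →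
    (s :: (cs ++ as)).Nodup →
    ∃ δ : (Q → Fin 2) → ℂ, (∀ x y, (∀ q ∈ cs ++ as, x q = y q) → δ x = δ y) ∧
      (∀ x, ‖δ x‖ = 1) ∧ ∀ b, eval (ladder b s cs as) =
        Matrix.diagonal (fun x => (if b then δ x else star (δ x)) *
          if x s = 1 ∧ ∀ c ∈ cs, x c = 1 then -1 else 1) := by
  induction as with
  | nil =>
    intro s cs hlen hnd
    match cs, hlen with
    | [c, c'], _ =>
      obtain ⟨hc, hc', -⟩ := ladder_nodup_pair hnd
      refine ⟨fun x => corePhase true (x c) (x c'), ?_, ?_, ?_⟩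
      · intro x y h
        simp only [h c (by simp), h c' (by simp)]
      · intro x
        simp only [corePhase, if_true]
        split_ifs <;> simp
      · intro b
        have e : ∀ u v, (if b then corePhase true u v else star (corePhase true u v)) =
            corePhase b u v := by
          intro u v
          cases b <;> simp [corePhase]
          split_ifs <;> simp
        simp only [e, ladder]
        funext x y
        rw [(isLocal_cczCore b s c c' hc hc').1, Matrix.diagonal_apply]
        have hz := congrFun (congrFun (controlled_pauliZ {c, c'} s) x) y
        rw [Matrix.diagonal_apply] at hz
        simp only [controlled, Finset.mem_insert, Finset.mem_singleton,
          forall_eq_or_imp, forall_eq] at hz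
        simp only [localOp, List.mem_cons, List.not_mem_nil, or_false,
          forall_eq_or_imp, forall_eq, Matrix.smul_apply, smul_eq_mul]
        have hz' : (if ∀ q, q ≠ s → x q = y q then corePhase b (y c) (y c') *
            (if y c = 1 ∧ y c' = 1 then pauliZ else 1) (x s) (y s) else 0) =
            corePhase b (y c) (y c') * (if x = y then
              (if x s = 1 ∧ x c = 1 ∧ x c' = 1 then (-1 : ℂ) else 1) else 0) := by
          rw [← hz]
          split_ifs <;> simp
        rw [hz']
        by_cases hxy : x = y
        · subst hxy; simp
        · simp [hxy]
  | cons a as ih =>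
    intro s cs hlen hnd
    match cs, hlen with
    | c :: cs, hlen =>
      obtain ⟨hn1, hsa, hca, -⟩ := ladder_nodup_cons hnd
      obtain ⟨δ, hδ, hn, hE⟩ := ih a cs (by simpa using hlen) hn1
      have ha : a ∉ cs ++ as := (List.nodup_cons.1 hn1).1
      refine ⟨fun x => δ x * if x a = 1 ∧ ∀ c ∈ cs, x c = 1 then -1 else 1, ?_, ?_, ?_⟩
      · intro x y h
        have h1 : ∀ q ∈ cs ++ as, x q = y q := fun q hq => h q (by
          simp only [List.mem_append, List.cons_append, List.mem_cons] at hq ⊢; tauto)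
        have h2 : x a = y a := h a (by simp)
        have h3 : (∀ c ∈ cs, x c = 1) ↔ ∀ c ∈ cs, y c = 1 :=
          forall_congr' fun q => forall_congr' fun hq => by rw [h1 q (by simp [hq])]
        simp only [hδ x y h1, h2, h3]
      · intro x
        rw [norm_mul, hn]
        split_ifs <;> simp
      · intro b
        simp only [ladder, eval_append, hE b]
        rw [← Matrix.mul_assoc, margolus_conj_diagonal s c a hsa hca]
        congr 1
        funext x
        have hoff : ∀ q ∈ cs ++ as, flipIf (fun x => x s = 1 ∧ x c = 1) a x q = x q :=
          fun q hq => flipIf_of_ne _ (fun e : q = a => ha (e ▸ hq)) x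
        have hP : (∀ q ∈ cs, flipIf (fun x => x s = 1 ∧ x c = 1) a x q = 1) ↔
            ∀ q ∈ cs, x q = 1 :=
          forall_congr' fun q => forall_congr' fun hq => by rw [hoff q (by simp [hq])]
        have hta := flipIf_self (fun x => x s = 1 ∧ x c = 1) a x
        rw [hδ _ x hoff]
        -- the outer Margolus gates flip `a` if `s` and `c` are in state 1, so that the sign of the
        -- inner ladder changes by the sign that is asserted for the outer one
        simp only [hP, hta, List.mem_cons, forall_eq_or_imp]
        have hxa : x a = 0 ∨ x a = 1 := by omega
        by_cases hp : ∀ q ∈ cs, x q = 1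
        · by_cases h1 : x s = 1 <;> by_cases h2 : x c = 1 <;> cases b <;>
            rcases hxa with h3 | h3 <;> simp [if_pos hp, h1, h2, h3]
        · by_cases h1 : x s = 1 <;> by_cases h2 : x c = 1 <;> cases b <;>
            rcases hxa with h3 | h3 <;> simp [hp, h1, h2, h3]

end Ladder

/-! ### Gate counts and levels of a ladder -/

section Levels

variable {Q : Type}

/-- The weight of a gate of kind `k'` in the count and depth of gates of kind `k`. -/
def wt (k k' : Kind) : ℕ := if k' = k then 1 else 0

theorem count_append (k : Kind) (c d : Circuit Q) : count k (c ++ d) = count k c + count k d := by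
  simp [count]

theorem count_cons (k : Kind) (g : Gate Q) (c : Circuit Q) :
    count k (g :: c) = wt k g.kind + count k c := by
  simp only [count, List.countP_cons, wt, decide_eq_true_eq]; ring

theorem count_nil (k : Kind) : count k ([] : Circuit Q) = 0 := rfl

theorem tGate_kind (b : Bool) (q : Q) : (tGate b q).kind = .t := by cases b <;> rfl

variable [DecidableEq Q]

theorem count_margolus (k : Kind) {s c a : Q} (hs : s ≠ a) (hc : c ≠ a) :
    count k (margolus s c a) = 3 * wt k .cnot + 4 * wt k .t + 2 * wt k .h := by
  simp only [margolus, cx_of_ne hs, cx_of_ne hc, count_append, count_cons, count_nil, Gate.kind]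
  ring

theorem count_cczCore (k : Kind) (b : Bool) {s c c' : Q} (hc : c ≠ s) (hc' : c' ≠ s) :
    count k (cczCore b s c c') = 4 * wt k .cnot + 4 * wt k .t := by
  simp only [cczCore, cx_of_ne hc, cx_of_ne hc', count_append, count_cons, count_nil, tGate_kind]
  simp only [Gate.kind]
  ring

theorem count_ladder (k : Kind) (b : Bool) (as : List Q) : ∀ (s : Q) (cs : List Q),
    cs.length = as.length + 2 → (s :: (cs ++ as)).Nodup →
    count k (ladder b s cs as) =
      2 * as.length * (3 * wt k .cnot + 4 * wt k .t + 2 * wt k .h) +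
        (4 * wt k .cnot + 4 * wt k .t) := by
  induction as with
  | nil =>
    intro s cs hlen hnd
    match cs, hlen with
    | [c, c'], _ =>
      obtain ⟨h1, h2, -⟩ := ladder_nodup_pair hnd
      simp [ladder, count_cczCore k b h1 h2]
  | cons a as ih =>
    intro s cs hlen hnd
    match cs, hlen with
    | c :: cs, hlen =>
      obtain ⟨h1, h2, h3, -⟩ := ladder_nodup_cons hnd
      simp only [ladder, count_append, count_margolus k h2 h3, ih a cs (by simpa using hlen) h1,
        List.length_cons]
      ring

/-- The levels of all qubits after a circuit that starts with levels `lev`. -/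
def levels (k : Kind) (c : Circuit Q) (lev : Q → ℕ) : Q → ℕ := c.foldl (stepLevel k) lev

theorem levels_append (k : Kind) (c d : Circuit Q) (lev : Q → ℕ) :
    levels k (c ++ d) lev = levels k d (levels k c lev) := List.foldl_append ..

theorem levels_cons (k : Kind) (g : Gate Q) (c : Circuit Q) (lev : Q → ℕ) :
    levels k (g :: c) lev = levels k c (stepLevel k lev g) := rfl

theorem levels_nil (k : Kind) (lev : Q → ℕ) : levels k [] lev = lev := rfl

theorem stepLevel_of_support_eq (k : Kind) (lev : Q → ℕ) {g : Gate Q} {q : Q}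
    (h : g.support = {q}) :
    stepLevel k lev g = Function.update lev q (lev q + wt k g.kind) := by
  funext p
  by_cases hp : p = q
  · subst hp; simp [stepLevel, h, wt]
  · simp [stepLevel, h, hp]

theorem stepLevel_cnot (k : Kind) (lev : Q → ℕ) {c t : Q} (h : c ≠ t) :
    stepLevel k lev (.CNOT c t h) =
      fun q => if q = c ∨ q = t then max (lev c) (lev t) + wt k .cnot else lev q := by
  funext p
  simp only [stepLevel, Gate.support, wt, Gate.kind, Finset.mem_insert, Finset.mem_singleton,
    Finset.sup_insert, Finset.sup_singleton]
  rfl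

theorem tGate_support (b : Bool) (q : Q) : (tGate b q).support = {q} := by cases b <;> rfl

/-- As `s` takes part in the central CNOT only, `c` and `a` are needed before `s`, by the depth of
one half of the circuit without the central CNOT, and are released later by the same amount. -/
theorem levels_margolus (k : Kind) {s c a : Q} (hs : s ≠ a) (hc : c ≠ a) (hsc : s ≠ c)
    {lev : Q → ℕ} {p : ℕ} (h1 : lev s ≤ p) (h2 : lev c + (wt k .h + 2 * wt k .t + wt k .cnot) ≤ p)
    (h3 : lev a + (wt k .h + 2 * wt k .t + wt k .cnot) ≤ p) :
    levels k (margolus s c a) lev s ≤ p + wt k .cnot ∧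
    levels k (margolus s c a) lev c ≤ p + wt k .cnot + (wt k .h + 2 * wt k .t + wt k .cnot) ∧
    levels k (margolus s c a) lev a ≤ p + wt k .cnot + (wt k .h + 2 * wt k .t + wt k .cnot) ∧
    ∀ q, q ≠ s → q ≠ c → q ≠ a → levels k (margolus s c a) lev q = lev q := by
  have e : ∀ ℓ : Q → ℕ, stepLevel k ℓ (.H a) = Function.update ℓ a (ℓ a + wt k .h) :=
    fun ℓ => stepLevel_of_support_eq k ℓ rfl
  have e1 : ∀ ℓ : Q → ℕ, stepLevel k ℓ (.T a) = Function.update ℓ a (ℓ a + wt k .t) :=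
    fun ℓ => stepLevel_of_support_eq k ℓ rfl
  have e2 : ∀ ℓ : Q → ℕ, stepLevel k ℓ (.Tdg a) = Function.update ℓ a (ℓ a + wt k .t) :=
    fun ℓ => stepLevel_of_support_eq k ℓ rfl
  simp only [margolus, cx_of_ne hs, cx_of_ne hc, List.cons_append, List.nil_append, levels_cons,
    levels_nil, e, e1, e2, stepLevel_cnot]
  refine ⟨?_, ?_, ?_, fun q q1 q2 q3 => ?_⟩
  · simp [Function.update_apply, hs, hc, hsc, hs.symm, hc.symm, hsc.symm]; omega
  · simp [Function.update_apply, hs, hc, hsc, hs.symm, hc.symm, hsc.symm]; omega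
  · simp [Function.update_apply, hs, hc, hsc, hs.symm, hc.symm, hsc.symm]; omega
  · simp [Function.update_apply, q1, q2, q3]

theorem levels_cczCore (k : Kind) (b : Bool) {s c c' : Q} (hc : c ≠ s) (hc' : c' ≠ s)
    (hcc : c ≠ c') {lev : Q → ℕ} {p : ℕ} (h1 : lev s ≤ p) (h2 : lev c ≤ p) (h3 : lev c' ≤ p) :
    levels k (cczCore b s c c') lev s ≤ p + (4 * wt k .cnot + 4 * wt k .t) ∧
    levels k (cczCore b s c c') lev c ≤ p + (4 * wt k .cnot + 4 * wt k .t) ∧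
    levels k (cczCore b s c c') lev c' ≤ p + (4 * wt k .cnot + 4 * wt k .t) ∧
    ∀ q, q ≠ s → q ≠ c → q ≠ c' → levels k (cczCore b s c c') lev q = lev q := by
  have e : ∀ (b : Bool) (ℓ : Q → ℕ),
      stepLevel k ℓ (tGate b s) = Function.update ℓ s (ℓ s + wt k .t) :=
    fun b ℓ => by rw [stepLevel_of_support_eq k ℓ (tGate_support b s), tGate_kind]
  simp only [cczCore, cx_of_ne hc, cx_of_ne hc', List.cons_append, List.nil_append, levels_cons,
    levels_nil, e, stepLevel_cnot]
  refine ⟨?_, ?_, ?_, fun q q1 q2 q3 => ?_⟩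
  · simp [Function.update_apply, hc, hc', hcc, hc.symm, hc'.symm, hcc.symm]; omega
  · simp [Function.update_apply, hc, hc', hcc, hc.symm, hc'.symm, hcc.symm]; omega
  · simp [Function.update_apply, hc, hc', hcc, hc.symm, hc'.symm, hcc.symm]; omega
  · simp [Function.update_apply, q1, q2, q3]

/-- Besides the qubits of the central gate, a ladder extends the levels by a constant for each of
its Margolus gates. It may start with its outermost gate early, and the outermost control and
ancilla are the only qubits on which it ends late. Here `f` is the depth of either half of a
Margolus gate without its central CNOT, `D` is the delay per Margolus gate, and `K` bounds the depth of the
central part of the ladder. -/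
theorem levels_ladder (k : Kind) (b : Bool) {f D K : ℕ}
    (hf : f = wt k .h + 2 * wt k .t + wt k .cnot) (hD : D = wt k .cnot + f)
    (hK : K = 4 * wt k .cnot + 4 * wt k .t) (as : List Q) :
    ∀ (s : Q) (cs : List Q) (lev : Q → ℕ) (p : ℕ), cs.length = as.length + 2 →
    (s :: (cs ++ as)).Nodup → (∀ q ∈ s :: (cs ++ as), lev q ≤ p) →
    (∀ q ∈ cs.take 1 ++ as.take 1, lev q + f ≤ p) →
    levels k (ladder b s cs as) lev s ≤ p + 2 * as.length * D + K ∧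
    (∀ q ∈ cs ++ as, levels k (ladder b s cs as) lev q ≤ p + 2 * as.length * D + K + f) ∧
    (∀ q ∈ cs.tail ++ as.tail, levels k (ladder b s cs as) lev q ≤ p + 2 * as.length * D + K) ∧
    (∀ q, q ∉ s :: (cs ++ as) → levels k (ladder b s cs as) lev q = lev q) := by
  induction as with
  | nil =>
    intro s cs lev p hlen hnd h1 h2
    match cs, hlen with
    | [c, c'], _ =>
      obtain ⟨n1, n2, n3⟩ := ladder_nodup_pair hnd
      simp only [List.cons_append, List.nil_append, List.mem_cons, List.not_mem_nil, or_false,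
        forall_eq_or_imp, forall_eq] at h1
      obtain ⟨l1, l2, l3, l4⟩ := levels_cczCore k b n1 n2 n3 h1.1 h1.2.1 h1.2.2
      subst hK
      simp only [ladder, List.append_nil, List.tail_cons, List.tail_nil, List.length_nil,
        List.mem_cons, List.not_mem_nil, or_false, forall_eq_or_imp, forall_eq, mul_zero, zero_mul,
        add_zero, not_or]
      refine ⟨l1, ⟨by omega, by omega⟩, l3, fun q hq => l4 q hq.1 hq.2.1 hq.2.2⟩
  | cons a as ih =>
    intro s cs lev p hlen hnd h1 h2
    match cs, hlen with
    | c :: cs, hlen =>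
      obtain ⟨n1, n2, n3, n4, n5, n6⟩ := ladder_nodup_cons hnd
      have n7 : a ∉ cs ++ as := (List.nodup_cons.1 n1).1
      have hc := h2 c (by simp)
      have ha := h2 a (by simp)
      rw [hf] at hc ha
      obtain ⟨l1, l2, l3, l4⟩ := levels_margolus k n2 n3 n4 (h1 s (by simp)) hc ha
      rw [← hf] at l2 l3
      set lev₁ := levels k (margolus s c a) lev with hlev₁
      have hoff : ∀ q ∈ cs ++ as, lev₁ q ≤ p := by
        intro q hq
        rw [l4 q (fun e => n5 (e ▸ hq)) (fun e => n6 (e ▸ hq)) (fun e => n7 (e ▸ hq))]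
        refine h1 q ?_
        simp only [List.mem_append, List.cons_append, List.mem_cons] at hq ⊢; tauto
      obtain ⟨m1, m2, m3, m4⟩ := ih a cs lev₁ (p + D) (by simpa using hlen) n1 (by
        intro q hq
        rcases List.mem_cons.1 hq with rfl | hq
        · omega
        · have := hoff q hq; omega) (by
        intro q hq
        have : lev₁ q ≤ p := hoff q (by
          rcases List.mem_append.1 hq with h | h
          · exact List.mem_append_left _ (List.mem_of_mem_take h)
          · exact List.mem_append_right _ (List.mem_of_mem_take h))
        omega)
      set lev₂ := levels k (ladder b a cs as) lev₁ with hlev₂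
      have e1 : lev₂ s = lev₁ s := m4 s (by simpa [n2] using n5)
      have e2 : lev₂ c = lev₁ c := m4 c (by simpa [n3] using n6)
      have hmul : 2 * (as.length + 1) * D = 2 * as.length * D + D + D := by ring
      obtain ⟨r1, r2, r3, r4⟩ := levels_margolus k (lev := lev₂)
        (p := p + D + 2 * as.length * D + K + f) n2 n3 n4 (by omega) (by omega) (by omega)
      rw [← hf] at r2 r3
      have e3 : levels k (ladder b s (c :: cs) (a :: as)) lev =
          levels k (margolus s c a) lev₂ := by
        simp only [ladder, levels_append, hlev₁, hlev₂]
      rw [e3, List.length_cons, hmul]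
      have r5 : ∀ q ∈ cs ++ as, levels k (margolus s c a) lev₂ q ≤
          p + (2 * as.length * D + D + D) + K := by
        intro q hq
        rw [r4 q (fun e => n5 (e ▸ hq)) (fun e => n6 (e ▸ hq)) (fun e => n7 (e ▸ hq))]
        have := m2 q hq
        omega
      refine ⟨by omega, ?_, r5, ?_⟩
      · intro q hq
        simp only [List.cons_append, List.mem_cons, List.mem_append] at hq
        rcases hq with rfl | hq | rfl | hq
        · omega
        · have := r5 q (List.mem_append_left _ hq); omega
        · omega
        · have := r5 q (List.mem_append_right _ hq); omega
      · intro q hq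
        simp only [List.cons_append, List.mem_cons, List.mem_append, not_or] at hq
        rw [r4 q hq.1 hq.2.1 hq.2.2.2.1, m4 q (by simp [hq]), l4 q hq.1 hq.2.1 hq.2.2.2.1]

/-- A ladder that follows a circuit in which only the qubits of `E` end late. -/
theorem levels_ladder_of_late (k : Kind) (b : Bool) {f D K : ℕ}
    (hf : f = wt k .h + 2 * wt k .t + wt k .cnot) (hD : D = wt k .cnot + f)
    (hK : K = 4 * wt k .cnot + 4 * wt k .t) (s : Q) (cs as : List Q) (lev : Q → ℕ) (p : ℕ)
    (hlen : cs.length = as.length + 2) (hnd : (s :: (cs ++ as)).Nodup) (E : List Q)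
    (h1 : ∀ q, lev q ≤ p + f) (h2 : ∀ q ∉ E, lev q ≤ p)
    (hE : ∀ q ∈ cs.take 1 ++ as.take 1, q ∉ E) :
    (∀ q, levels k (ladder b s cs as) lev q ≤ p + f + 2 * as.length * D + K + f) ∧
    (∀ q ∉ cs.take 1 ++ as.take 1,
      levels k (ladder b s cs as) lev q ≤ p + f + 2 * as.length * D + K) := by
  obtain ⟨m1, m2, m3, m4⟩ := levels_ladder k b hf hD hK as s cs lev (p + f) hlen hnd
    (fun q _ => h1 q) (fun q hq => by have := h2 q (hE q hq); omega)
  have htail : ∀ (l : List Q) (q : Q), q ∈ l → q ∉ l.take 1 → q ∈ l.tail := by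
    intro l q; cases l <;> simp; tauto
  constructor
  · intro q
    by_cases hq : q ∈ s :: (cs ++ as)
    · rcases List.mem_cons.1 hq with rfl | hq
      · omega
      · exact m2 q hq
    · rw [m4 q hq]; have := h1 q; omega
  · intro q hE'
    by_cases hq : q ∈ s :: (cs ++ as)
    · rcases List.mem_cons.1 hq with rfl | hq
      · omega
      · refine m3 q ?_
        simp only [List.mem_append, not_or] at hE' hq ⊢
        exact hq.imp (fun h => htail _ _ h hE'.1) (fun h => htail _ _ h hE'.2)
    · rw [m4 q hq]; have := h1 q; omega

end Levels

/-! ### Operators on controls and targets -/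

section Algebra

variable {n m : ℕ}

/-- The operator that applies the matrix `G c j` to the `j`-th target for every `j`, if the controls
are in the basis state `c`. -/
def pop (G : (Fin n → Fin 2) → Fin m → Matrix (Fin 2) (Fin 2) ℂ) : Op (Fin n ⊕ Fin m) :=
  fun x y => if x ∘ Sum.inl = y ∘ Sum.inl then
    ∏ j, G (x ∘ Sum.inl) j (x (Sum.inr j)) (y (Sum.inr j)) else 0

/-- The operator `V` on the controls, with the identity on all targets. -/
def ctl (V : Op (Fin n)) : Op (Fin n ⊕ Fin m) :=
  fun x y => if x ∘ Sum.inr = y ∘ Sum.inr then V (x ∘ Sum.inl) (y ∘ Sum.inl) else 0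

/-- The operator `T` on the targets, with the identity on all controls. -/
def tgt (T : Op (Fin m)) : Op (Fin n ⊕ Fin m) :=
  fun x y => if x ∘ Sum.inl = y ∘ Sum.inl then T (x ∘ Sum.inr) (y ∘ Sum.inr) else 0

theorem sum_basis (f : (Fin n ⊕ Fin m → Fin 2) → ℂ) :
    ∑ z, f z = ∑ c : Fin n → Fin 2, ∑ w : Fin m → Fin 2, f (Sum.elim c w) := by
  rw [← Fintype.sum_prod_type' (f := fun c w => f (Sum.elim c w))]
  exact Fintype.sum_equiv (Equiv.sumArrowEquivProdArrow _ _ _) _ _ (fun z => by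
    simp [Equiv.sumArrowEquivProdArrow])

theorem basis_ext {x y : Fin n ⊕ Fin m → Fin 2} :
    x = y ↔ x ∘ Sum.inl = y ∘ Sum.inl ∧ x ∘ Sum.inr = y ∘ Sum.inr := by
  simp [funext_iff]

theorem pop_mul (G H : (Fin n → Fin 2) → Fin m → Matrix (Fin 2) (Fin 2) ℂ) :
    pop G * pop H = pop (fun c j => G c j * H c j) := by
  funext x y
  rw [Matrix.mul_apply, sum_basis]
  simp only [pop, Sum.elim_comp_inl, Sum.elim_inr]
  rw [Finset.sum_eq_single (x ∘ Sum.inl)]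
  · by_cases h : x ∘ Sum.inl = y ∘ Sum.inl
    · simp only [h, if_true, ← Finset.prod_mul_distrib, Matrix.mul_apply]
      exact (Fintype.prod_sum (fun j b => G (y ∘ Sum.inl) j (x (Sum.inr j)) b *
        H (y ∘ Sum.inl) j b (y (Sum.inr j)))).symm
    · simp [h]
  · intro c _ hc
    simp [hc.symm]
  · simp

theorem ctl_elim_right (V : Op (Fin n)) (x : Fin n ⊕ Fin m → Fin 2) (c : Fin n → Fin 2)
    (w : Fin m → Fin 2) :
    ctl V x (Sum.elim c w) = if x ∘ Sum.inr = w then V (x ∘ Sum.inl) c else 0 := rfl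

theorem ctl_elim_left (V : Op (Fin n)) (y : Fin n ⊕ Fin m → Fin 2) (c : Fin n → Fin 2)
    (w : Fin m → Fin 2) :
    ctl V (Sum.elim c w) y = if w = y ∘ Sum.inr then V c (y ∘ Sum.inl) else 0 := rfl

theorem tgt_elim_right (T : Op (Fin m)) (x : Fin n ⊕ Fin m → Fin 2) (c : Fin n → Fin 2)
    (w : Fin m → Fin 2) :
    tgt T x (Sum.elim c w) = if x ∘ Sum.inl = c then T (x ∘ Sum.inr) w else 0 := rfl

theorem tgt_elim_left (T : Op (Fin m)) (y : Fin n ⊕ Fin m → Fin 2) (c : Fin n → Fin 2)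
    (w : Fin m → Fin 2) :
    tgt T (Sum.elim c w) y = if c = y ∘ Sum.inl then T w (y ∘ Sum.inr) else 0 := rfl

theorem ctl_mul (V V' : Op (Fin n)) : (ctl V * ctl V' : Op (Fin n ⊕ Fin m)) = ctl (V * V') := by
  funext x y
  rw [Matrix.mul_apply, sum_basis]
  simp only [ctl_elim_left, ctl_elim_right, ite_mul, zero_mul, mul_ite, mul_zero]
  simp only [ctl, Matrix.mul_apply]
  by_cases h : x ∘ Sum.inr = y ∘ Sum.inr <;> simp [h]

theorem ctl_one : (ctl 1 : Op (Fin n ⊕ Fin m)) = 1 := by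
  funext x y
  simp only [ctl, Matrix.one_apply, basis_ext (x := x) (y := y)]
  split_ifs <;> tauto

theorem commute_ctl_tgt (V : Op (Fin n)) (T : Op (Fin m)) : Commute (ctl V) (tgt T) := by
  funext x y
  simp only [Matrix.mul_apply, sum_basis, ctl_elim_left, ctl_elim_right, tgt_elim_left,
    tgt_elim_right, ite_mul, zero_mul, mul_ite, mul_zero]
  simp [mul_comm]

theorem ctl_diagonal (δ : (Fin n → Fin 2) → ℂ) :
    (ctl (Matrix.diagonal δ) : Op (Fin n ⊕ Fin m)) =
      Matrix.diagonal (fun x => δ (x ∘ Sum.inl)) := by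
  funext x y
  simp only [ctl, Matrix.diagonal_apply, basis_ext (x := x) (y := y)]
  split_ifs <;> tauto

theorem commute_ctl_diagonal_pop (δ : (Fin n → Fin 2) → ℂ)
    (G : (Fin n → Fin 2) → Fin m → Matrix (Fin 2) (Fin 2) ℂ) :
    Commute (ctl (Matrix.diagonal δ)) (pop G) := by
  rw [ctl_diagonal]
  funext x y
  change (Matrix.diagonal (fun x => δ (x ∘ Sum.inl)) * pop G : Op (Fin n ⊕ Fin m)) x y =
    (pop G * Matrix.diagonal (fun x => δ (x ∘ Sum.inl)) : Op (Fin n ⊕ Fin m)) x y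
  rw [Matrix.diagonal_mul, Matrix.mul_diagonal, mul_comm]
  by_cases h : x ∘ Sum.inl = y ∘ Sum.inl
  · rw [h]
  · simp [pop, h]

theorem pop_const (A : Fin m → Matrix (Fin 2) (Fin 2) ℂ) :
    (pop (fun _ => A) : Op (Fin n ⊕ Fin m)) = tgt (fun u v => ∏ j, A j (u j) (v j)) := rfl

theorem pop_one : (pop (fun _ _ => 1) : Op (Fin n ⊕ Fin m)) = 1 := by
  funext x y
  simp only [pop, Matrix.one_apply, basis_ext (x := x) (y := y), Finset.prod_ite_zero]
  by_cases h : x ∘ Sum.inl = y ∘ Sum.inl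
  · simp [h, funext_iff]
  · simp [h]

theorem controlled_inr (C : Finset (Fin n)) (j : Fin m) (M : Matrix (Fin 2) (Fin 2) ℂ) :
    controlled (C.map Function.Embedding.inl) (Sum.inr j) M =
      pop (fun c => Function.update 1 j (if ∀ i ∈ C, c i = 1 then M else 1)) := by
  funext x y
  have e : (∀ q, q ≠ Sum.inr j → x q = y q) ↔
      x ∘ Sum.inl = y ∘ Sum.inl ∧ ∀ j', j' ≠ j → x (Sum.inr j') = y (Sum.inr j') := by
    simp [funext_iff]
  simp only [controlled, pop, e]
  by_cases h : x ∘ Sum.inl = y ∘ Sum.inl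
  · by_cases h' : ∀ j', j' ≠ j → x (Sum.inr j') = y (Sum.inr j')
    · rw [if_pos ⟨h, h'⟩, if_pos h, Fintype.prod_eq_single j]
      · have : (∀ q ∈ C.map Function.Embedding.inl, y q = 1) ↔
            ∀ i ∈ C, (x ∘ Sum.inl) i = 1 := by rw [h]; simp
        simp only [this, Function.update_self]
        split_ifs <;> rfl
      · intro j' hj
        simp [hj, h' j' hj]
    · rw [if_neg (fun hh => h' hh.2), if_pos h]
      push Not at h'
      obtain ⟨j', hj, hne⟩ := h'
      exact (Finset.prod_eq_zero (Finset.mem_univ j') (by simp [hj, hne])).symm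
  · rw [if_neg (fun hh => h hh.1), if_neg h]

theorem controlled_inr_one (j : Fin m) (M : Matrix (Fin 2) (Fin 2) ℂ) :
    (controlled ∅ (Sum.inr j) M : Op (Fin n ⊕ Fin m)) =
      pop (fun _ => Function.update 1 j M) := by
  simpa using controlled_inr (n := n) ∅ j M

theorem multiControlledMultiTarget_eq (W : Fin m → Matrix (Fin 2) (Fin 2) ℂ) :
    multiControlledMultiTarget n m W = pop (fun c j => if ∀ i, c i = 1 then W j else 1) := by
  have key : ∀ l : List (Fin m), l.Nodup →
      (l.map fun j => controlled (Finset.univ.map Function.Embedding.inl) (Sum.inr j) (W j)).prod =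
      (pop (fun c j => if j ∈ l then (if ∀ i, c i = 1 then W j else 1) else 1) :
        Op (Fin n ⊕ Fin m)) := by
    intro l hl
    induction l with
    | nil => simp [pop_one]
    | cons j l ih =>
      rw [List.nodup_cons] at hl
      rw [List.map_cons, List.prod_cons, ih hl.2, controlled_inr, pop_mul]
      congr 1
      funext c j'
      by_cases h : j' = j
      · subst h; simp [hl.1]
      · simp [h]
  rw [multiControlledMultiTarget, List.ofFn_eq_map, key _ (List.nodup_finRange m)]
  simp

/-- A layer of gates, one on each target, applies its matrices to all targets. -/
theorem eval_layer (g : Fin m → Gate (Fin n ⊕ Fin m)) (A : Fin m → Matrix (Fin 2) (Fin 2) ℂ)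
    (h : ∀ j, (g j).toOp = controlled ∅ (Sum.inr j) (A j)) :
    eval ((List.finRange m).map g) = pop (fun _ => A) := by
  have key : ∀ l : List (Fin m), l.Nodup →
      eval (l.map g) = pop (fun _ j => if j ∈ l then A j else 1) := by
    intro l hl
    induction l with
    | nil => simp [pop_one, eval]
    | cons j l ih =>
      rw [List.nodup_cons] at hl
      rw [List.map_cons, eval, ih hl.2, h, controlled_inr_one, pop_mul]
      congr 1
      funext c j'
      by_cases h : j' = j
      · subst h; simp [hl.1]
      · simp [h]
  rw [key _ (List.nodup_finRange m)]
  simp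

theorem rotX_mul (a b : ℝ) : rotX a * rotX b = rotX (a + b) := by
  have hI := Complex.I_mul_I
  ext i j
  fin_cases i <;> fin_cases j <;>
    simp [rotX, Matrix.mul_apply, Fin.sum_univ_two, add_div, Complex.cos_add, Complex.sin_add]
  · linear_combination Complex.sin (a / 2) * Complex.sin (b / 2) * hI
  · ring
  · ring
  · linear_combination Complex.sin (a / 2) * Complex.sin (b / 2) * hI

theorem rotX_zero : rotX 0 = 1 := by
  ext i j; fin_cases i <;> fin_cases j <;> simp [rotX]

theorem rotZ_neg_mul (a : ℝ) : rotZ (-a) * rotZ a = 1 := by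
  ext i j
  fin_cases i <;> fin_cases j <;>
    simp [rotZ, Matrix.mul_apply, Fin.sum_univ_two, ← Complex.exp_add, neg_div]

theorem pauliZ_rotX (a : ℝ) : pauliZ * rotX a * pauliZ = rotX (-a) := by
  ext i j
  fin_cases i <;> fin_cases j <;>
    simp [rotX, pauliZ, Matrix.mul_apply, Fin.sum_univ_two, neg_div]

/-- The rotations cancel unless both signs are present, in which case they add up. -/
theorem rotation_identity (s₁ s₂ : Prop) [Decidable s₁] [Decidable s₂] (lam θ₁ θ₂ : ℝ) :
    (rotX (-θ₁) * rotZ (-θ₂) * rotX (lam / 4)) * (if s₂ then pauliZ else 1) * rotX (-(lam / 4)) *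
      (if s₁ then pauliZ else 1) * rotX (lam / 4) * (if s₂ then pauliZ else 1) *
      rotX (-(lam / 4)) * (if s₁ then pauliZ else 1) * (rotZ θ₂ * rotX θ₁) =
    if s₁ ∧ s₂ then rotX (-θ₁) * rotZ (-θ₂) * rotX lam * rotZ θ₂ * rotX θ₁ else 1 := by
  set a := lam / 4 with ha
  have h1 : rotX (-θ₁) * rotX θ₁ = 1 := by rw [rotX_mul, neg_add_cancel, rotX_zero]
  have h2 := rotZ_neg_mul θ₂
  have hz : ∀ b, pauliZ * rotX b = rotX (-b) * pauliZ := fun b => by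
    rw [← pauliZ_rotX b, Matrix.mul_assoc _ pauliZ, pauliZ_mul_self, Matrix.mul_one]
  have hza : ∀ b A, pauliZ * (rotX b * A) = rotX (-b) * (pauliZ * A) := fun b A => by
    rw [← Matrix.mul_assoc, hz, Matrix.mul_assoc]
  have hzz : ∀ A, pauliZ * (pauliZ * A) = A := fun A => by
    rw [← Matrix.mul_assoc, pauliZ_mul_self, Matrix.one_mul]
  have hxx : ∀ b c A, rotX b * (rotX c * A) = rotX (b + c) * A := fun b c A => by
    rw [← Matrix.mul_assoc, rotX_mul]
  have h2' : ∀ A, rotZ (-θ₂) * (rotZ θ₂ * A) = A := fun A => by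
    rw [← Matrix.mul_assoc, h2, Matrix.one_mul]
  -- moving a `Z` to the right past rotations about the x axis negates their angles
  have e : lam = a + (- -a + (a + - -a)) := by rw [ha]; ring
  by_cases k1 : s₁ <;> by_cases k2 : s₂ <;>
    simp only [k1, k2, if_true, if_false, Matrix.mul_one, Matrix.mul_assoc, hza,
      hzz, hxx, and_self, and_true, and_false]
  · congr 3
    congr 1
    rw [e]; ring
  · have : a + (-a + (- a + - -a)) = 0 := by ring
    ring_nf
    simp [rotX_zero, h2', h1]
  · ring_nf
    simp [rotX_zero, h2', h1]
  · ring_nf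
    simp [rotX_zero, h2', h1]

end Algebra

/-! ### The macro structure for any number of targets -/

section Macro

variable {n m : ℕ}

/-- The gate that applies `Z` to all targets if all the controls in `C` are in state 1. -/
noncomputable def multiZ (C : Finset (Fin n)) : Op (Fin n ⊕ Fin m) :=
  pop (fun c _ => if ∀ i ∈ C, c i = 1 then pauliZ else 1)

theorem ctl_conj_pop_const {V : Op (Fin n)} (h : Vᴴ * V = 1)
    (A : Fin m → Matrix (Fin 2) (Fin 2) ℂ) (B : Op (Fin n ⊕ Fin m)) :
    ctl Vᴴ * (pop (fun _ => A) * (ctl V * B)) = pop (fun _ => A) * B := by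
  have h1 : (ctl Vᴴ * pop (fun _ => A) : Op (Fin n ⊕ Fin m)) = pop (fun _ => A) * ctl Vᴴ := by
    rw [pop_const]; exact (commute_ctl_tgt Vᴴ _).eq
  rw [← Matrix.mul_assoc, h1, Matrix.mul_assoc, ← Matrix.mul_assoc (ctl Vᴴ), ctl_mul, h, ctl_one,
    Matrix.one_mul]

theorem ctl_diagonal_cancel {δ : (Fin n → Fin 2) → ℂ} (h : ∀ x, ‖δ x‖ = 1) :
    (ctl (Matrix.diagonal δ)ᴴ * ctl (Matrix.diagonal δ) : Op (Fin n ⊕ Fin m)) = 1 := by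
  rw [ctl_mul, Matrix.diagonal_conjTranspose, Matrix.diagonal_mul_diagonal]
  have : (fun i => star δ i * δ i) = fun _ => 1 := by
    funext i
    have := Complex.conj_mul' (δ i)
    rw [h i] at this
    simpa using this
  rw [this, Matrix.diagonal_one, ctl_one]

/-- In the alternating product of blocks, the phases of equal blocks cancel as they commute with
everything in between. -/
theorem phases_cancel {M : Type*} [Monoid M] {d₁ d₁' d₂ d₂' z₁ z₂ a₂ a₃ : M} (a₁ a₄ : M)
    (h₁ : d₁' * d₁ = 1) (h₂ : d₂' * d₂ = 1) (hd : Commute d₂ d₁')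
    (hz₁ : ∀ d ∈ [d₁, d₂], Commute d z₁) (hz₂ : ∀ d ∈ [d₁, d₂], Commute d z₂)
    (ha₂ : ∀ d ∈ [d₁, d₂], Commute d a₂) (ha₃ : ∀ d ∈ [d₁, d₂], Commute d a₃) :
    a₁ * (d₂' * (z₂ * (a₂ * (d₁' * (z₁ * (a₃ * (d₂ * (z₂ * (a₂ * (d₁ * (z₁ * a₄))))))))))) =
      a₁ * z₂ * a₂ * z₁ * a₃ * z₂ * a₂ * z₁ * a₄ := by
  simp only [List.mem_cons, List.not_mem_nil, or_false, forall_eq_or_imp, forall_eq]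
    at hz₁ hz₂ ha₂ ha₃
  have c₂ : d₂ * (z₂ * a₂ * d₁' * z₁ * a₃) = z₂ * a₂ * d₁' * z₁ * a₃ * d₂ :=
    ((((hz₂.2.mul_right ha₂.2).mul_right hd).mul_right hz₁.2).mul_right ha₃.2).eq
  have c₁ : d₁ * (z₁ * a₃ * z₂ * a₂) = z₁ * a₃ * z₂ * a₂ * d₁ :=
    (((hz₁.1.mul_right ha₃.1).mul_right hz₂.1).mul_right ha₂.1).eq
  calc _ = a₁ * d₂' * (z₂ * a₂ * d₁' * z₁ * a₃ * d₂) * (z₂ * a₂ * d₁ * z₁ * a₄) := by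
        simp only [mul_assoc]
    _ = a₁ * (d₂' * d₂) * z₂ * a₂ * d₁' * (z₁ * a₃ * z₂ * a₂ * d₁) * z₁ * a₄ := by
        rw [← c₂]; simp only [mul_assoc]
    _ = a₁ * (d₂' * d₂) * z₂ * a₂ * (d₁' * d₁) * z₁ * a₃ * z₂ * a₂ * z₁ * a₄ := by
        rw [← c₁]; simp only [mul_assoc]
    _ = _ := by rw [h₁, h₂, mul_one, mul_one]

/-- If the four blocks have the form that the macro structure requires, for any number of targets,
then the phases and the operators on the controls cancel. -/
theorem macro_identity {C₁ C₂ : Finset (Fin n)} (hC : C₁ ∪ C₂ = Finset.univ)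
    {δ₁ δ₂ : (Fin n → Fin 2) → ℂ} (hδ₁ : ∀ x, ‖δ₁ x‖ = 1) (hδ₂ : ∀ x, ‖δ₂ x‖ = 1)
    {V₁ V₂ V₃ : Op (Fin n)} (h₁ : V₁ᴴ * V₁ = 1) (h₂ : V₂ᴴ * V₂ = 1) (h₃ : V₃ᴴ * V₃ = 1)
    {B₁ B₂ B₃ B₄ : Op (Fin n ⊕ Fin m)}
    (hB₁ : B₁ = ctl V₁ * (ctl (Matrix.diagonal δ₁) * multiZ C₁))
    (hB₂ : B₂ = ctl V₂ * (ctl (Matrix.diagonal δ₂) * multiZ C₂) * ctl V₁ᴴ)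
    (hB₃ : B₃ = ctl V₃ * (ctl (Matrix.diagonal δ₁)ᴴ * multiZ C₁) * ctl V₂ᴴ)
    (hB₄ : B₄ = ctl (Matrix.diagonal δ₂)ᴴ * multiZ C₂ * ctl V₃ᴴ)
    (lam θ₁ θ₂ : Fin m → ℝ) :
    pop (fun _ j => rotX (-θ₁ j) * rotZ (-θ₂ j) * rotX (lam j / 4)) * B₄ *
      pop (fun _ j => rotX (-(lam j / 4))) * B₃ * pop (fun _ j => rotX (lam j / 4)) * B₂ *
      pop (fun _ j => rotX (-(lam j / 4))) * B₁ * pop (fun _ j => rotZ (θ₂ j) * rotX (θ₁ j)) =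
    multiControlledMultiTarget n m
      (fun j => rotX (-θ₁ j) * rotZ (-θ₂ j) * rotX (lam j) * rotZ (θ₂ j) * rotX (θ₁ j)) := by
  subst hB₁ hB₂ hB₃ hB₄
  simp only [Matrix.mul_assoc]
  rw [ctl_conj_pop_const h₃, ctl_conj_pop_const h₂, ctl_conj_pop_const h₁]
  rw [Matrix.diagonal_conjTranspose, Matrix.diagonal_conjTranspose]
  have e₁ := ctl_diagonal_cancel (m := m) hδ₁
  have e₂ := ctl_diagonal_cancel (m := m) hδ₂
  rw [Matrix.diagonal_conjTranspose] at e₁ e₂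
  have comm : ∀ (δ δ' : (Fin n → Fin 2) → ℂ),
      Commute (ctl (Matrix.diagonal δ) : Op (Fin n ⊕ Fin m)) (ctl (Matrix.diagonal δ')) := by
    intro δ δ'
    rw [Commute, SemiconjBy, ctl_mul, ctl_mul, Matrix.diagonal_mul_diagonal,
      Matrix.diagonal_mul_diagonal]
    simp only [mul_comm]
  have hc : ∀ (G : (Fin n → Fin 2) → Fin m → Matrix (Fin 2) (Fin 2) ℂ),
      ∀ d ∈ [(ctl (Matrix.diagonal δ₁) : Op (Fin n ⊕ Fin m)), ctl (Matrix.diagonal δ₂)],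
      Commute d (pop G) := by
    intro G d hd
    simp only [List.mem_cons, List.not_mem_nil, or_false] at hd
    rcases hd with rfl | rfl
    · exact commute_ctl_diagonal_pop δ₁ G
    · exact commute_ctl_diagonal_pop δ₂ G
  unfold multiZ
  refine (phases_cancel _ _ e₁ e₂ (comm δ₂ (star δ₁)) (hc _) (hc _) (hc _) (hc _)).trans ?_
  rw [multiControlledMultiTarget_eq]
  simp only [pop_mul]
  congr 1
  funext c j
  have hrot := rotation_identity (∀ i ∈ C₁, c i = 1) (∀ i ∈ C₂, c i = 1) (lam j) (θ₁ j) (θ₂ j)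
  simp only [Matrix.mul_assoc] at hrot ⊢
  rw [hrot]
  refine if_congr ?_ rfl rfl
  constructor
  · rintro ⟨k₁, k₂⟩ i
    have := Finset.mem_univ i
    rw [← hC, Finset.mem_union] at this
    exact this.elim (k₁ i) (k₂ i)
  · exact fun h => ⟨fun i _ => h i, fun i _ => h i⟩

end Macro

/-! ### Renaming of qubits -/

/-- The gate with its qubits renamed along an embedding of registers. -/
def Gate.map {Q Q' : Type} (ι : Q ↪ Q') : Gate Q → Gate Q'
  | .H q => .H (ι q)
  | .T q => .T (ι q)
  | .Tdg q => .Tdg (ι q)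
  | .Rx θ q => .Rx θ (ι q)
  | .Rz θ q => .Rz θ (ι q)
  | .CNOT c t h => .CNOT (ι c) (ι t) (fun e => h (ι.injective e))

theorem Gate.map_kind {Q Q' : Type} (ι : Q ↪ Q') (g : Gate Q) : (g.map ι).kind = g.kind := by
  cases g <;> rfl

theorem count_map {Q Q' : Type} (ι : Q ↪ Q') (k : Kind) (c : Circuit Q) :
    count k (c.map (Gate.map ι)) = count k c := by
  simp only [count, List.countP_map]
  congr 1
  funext g
  simp [Gate.map_kind]

section Extension

variable {Q Q' : Type}

theorem agree_off_range_iff (ι : Q ↪ Q') (x y : Q' → Fin 2) :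
    (∀ q, (∀ p, ι p ≠ q) → x q = y q) ↔ x = Function.extend ι (x ∘ ι) y := by
  constructor
  · intro h
    funext q
    by_cases hq : ∃ p, ι p = q
    · obtain ⟨p, rfl⟩ := hq
      rw [ι.injective.extend_apply]; rfl
    · rw [Function.extend_apply' _ _ _ hq]
      exact h q (fun p hp => hq ⟨p, hp⟩)
  · intro h q hq
    rw [h, Function.extend_apply' _ _ _ (fun ⟨p, hp⟩ => hq p hp)]

theorem Gate.support_map [DecidableEq Q] [DecidableEq Q'] (ι : Q ↪ Q') (g : Gate Q) :
    (g.map ι).support = g.support.map ι := by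
  cases g <;> simp [Gate.map, Gate.support]

variable [Fintype Q] [Fintype Q'] [DecidableEq Q']

/-- The operator `A` on the qubits in the range of `ι`, with the identity on all other qubits. -/
def ext (ι : Q ↪ Q') (A : Op Q) : Op Q' :=
  fun x y => if ∀ q, (∀ p, ι p ≠ q) → x q = y q then A (x ∘ ι) (y ∘ ι) else 0

theorem ext_one (ι : Q ↪ Q') : ext ι (1 : Op Q) = 1 := by
  funext x y
  simp only [ext, Matrix.one_apply]
  by_cases h : ∀ q, (∀ p, ι p ≠ q) → x q = y q
  · rw [if_pos h]
    refine if_congr ⟨fun e => ?_, fun e => by rw [e]⟩ rfl rfl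
    rw [(agree_off_range_iff ι x y).1 h, e]
    funext q
    by_cases hq : ∃ p, ι p = q
    · obtain ⟨p, rfl⟩ := hq
      rw [ι.injective.extend_apply]; rfl
    · rw [Function.extend_apply' _ _ _ hq]
  · rw [if_neg h, if_neg]
    rintro rfl
    exact h fun _ _ => rfl

variable [DecidableEq Q]

theorem ext_mul (ι : Q ↪ Q') (A B : Op Q) : ext ι (A * B) = ext ι A * ext ι B := by
  funext x y
  rw [Matrix.mul_apply]
  have hcomp : ∀ w : Q → Fin 2, Function.extend ι w y ∘ ι = w := fun w => by
    funext p; exact ι.injective.extend_apply w y p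
  have hoff : ∀ (w : Q → Fin 2) (q : Q'), (∀ p, ι p ≠ q) → Function.extend ι w y q = y q :=
    fun w q hq => Function.extend_apply' _ _ _ (fun ⟨p, hp⟩ => hq p hp)
  have hinj : Function.Injective (fun w : Q → Fin 2 => Function.extend ι w y) := fun w w' h => by
    rw [← hcomp w, ← hcomp w', show Function.extend ι w y = Function.extend ι w' y from h]
  rw [← Fintype.sum_of_injective _ hinj
    (fun w => ext ι A x (Function.extend ι w y) * ext ι B (Function.extend ι w y) y)]
  · have h1 : ∀ w, (∀ q, (∀ p, ι p ≠ q) → x q = Function.extend ι w y q) ↔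
        ∀ q, (∀ p, ι p ≠ q) → x q = y q := by
      intro w
      refine forall_congr' fun q => forall_congr' fun hq => ?_
      rw [hoff w q hq]
    simp only [ext, h1, hcomp]
    by_cases hx : ∀ q, (∀ p, ι p ≠ q) → x q = y q
    · simp only [if_pos hx, if_pos (hoff _), Matrix.mul_apply]
    · simp [if_neg hx]
  · intro z hz
    have : ¬ ∀ q, (∀ p, ι p ≠ q) → z q = y q := fun h =>
      hz ⟨z ∘ ι, ((agree_off_range_iff ι z y).1 h).symm⟩
    simp [ext, if_neg this]
  · intro w; rfl

theorem ext_controlled (ι : Q ↪ Q') (C : Finset Q) (t : Q) (M : Matrix (Fin 2) (Fin 2) ℂ) :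
    ext ι (controlled C t M) = controlled (C.map ι) (ι t) M := by
  funext x y
  have e1 : (∀ q, q ≠ ι t → x q = y q) ↔ (∀ q, (∀ p, ι p ≠ q) → x q = y q) ∧
      ∀ p, p ≠ t → x (ι p) = y (ι p) := by
    constructor
    · exact fun h => ⟨fun q hq => h q (hq t).symm, fun p hp => h _ (fun e => hp (ι.injective e))⟩
    · rintro ⟨h1, h2⟩ q hq
      by_cases hr : ∃ p, ι p = q
      · obtain ⟨p, rfl⟩ := hr
        exact h2 p (fun e => hq (by rw [e]))
      · exact h1 q (fun p hp => hr ⟨p, hp⟩)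
  have e2 : (∀ q ∈ C.map ι, y q = 1) ↔ ∀ p ∈ C, y (ι p) = 1 := by simp
  simp only [ext, controlled, e1, e2, Function.comp]
  split_ifs <;> first | rfl | tauto

theorem Gate.toOp_map (ι : Q ↪ Q') (g : Gate Q) : (g.map ι).toOp = ext ι g.toOp := by
  cases g <;> simp [Gate.map, Gate.toOp, ext_controlled]

theorem eval_map (ι : Q ↪ Q') (c : Circuit Q) : eval (c.map (Gate.map ι)) = ext ι (eval c) := by
  induction c with
  | nil => simp [eval, ext_one]
  | cons g c ih => rw [List.map_cons, eval, eval, ih, Gate.toOp_map, ext_mul]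

end Extension

section Targets

variable {n m : ℕ}

theorem onControls_eq (V : Op (Fin n)) : onControls V = ctl V := by
  funext x y
  simp only [onControls, ctl]
  refine if_congr ?_ rfl rfl
  simp [funext_iff]

/-- The embedding of a register with a single target that uses the first target. -/
def firstTarget (n : ℕ) (hm : 0 < m) : Fin n ⊕ Fin 1 ↪ Fin n ⊕ Fin m :=
  ⟨Sum.elim Sum.inl (fun _ => Sum.inr ⟨0, hm⟩), by
    rintro (a | a) (b | b) h <;> simp_all; omega⟩

theorem firstTarget_inl (hm : 0 < m) (i : Fin n) : firstTarget n hm (Sum.inl i) = Sum.inl i := rfl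

theorem firstTarget_inr (hm : 0 < m) (j : Fin 1) :
    firstTarget n hm (Sum.inr j) = Sum.inr ⟨0, hm⟩ := rfl

theorem ext_onControls (hm : 0 < m) (V : Op (Fin n)) :
    ext (firstTarget n hm) (onControls V) = ctl V := by
  funext x y
  have e : x ∘ Sum.inr = y ∘ Sum.inr ↔
      (∀ q, (∀ p, firstTarget n hm p ≠ q) → x q = y q) ∧
        x (Sum.inr ⟨0, hm⟩) = y (Sum.inr ⟨0, hm⟩) := by
    constructor
    · intro h
      refine ⟨?_, congrFun h _⟩
      rintro (i | j) hq
      · exact absurd rfl (hq (Sum.inl i))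
      · exact congrFun h j
    · rintro ⟨h1, h2⟩
      funext j
      by_cases hj : j = ⟨0, hm⟩
      · subst hj; exact h2
      · refine h1 _ ?_
        rintro (i | i) hi
        · simp [firstTarget_inl] at hi
        · rw [firstTarget_inr, Sum.inr.injEq] at hi
          exact hj hi.symm
  rw [ctl, if_congr e rfl rfl]
  change (if ∀ q, (∀ p, firstTarget n hm p ≠ q) → x q = y q then
    (if x (Sum.inr ⟨0, hm⟩) = y (Sum.inr ⟨0, hm⟩) then V (x ∘ Sum.inl) (y ∘ Sum.inl) else 0)
    else 0) = _
  by_cases h1 : ∀ q, (∀ p, firstTarget n hm p ≠ q) → x q = y q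
  · by_cases h2 : x (Sum.inr ⟨0, hm⟩) = y (Sum.inr ⟨0, hm⟩)
    · rw [if_pos h1, if_pos h2, if_pos ⟨h1, h2⟩]
    · rw [if_pos h1, if_neg h2, if_neg (fun h => h2 h.2)]
  · rw [if_neg h1, if_neg (fun h => h1 h.1)]

theorem ext_mcz (hm : 0 < m) (C : Finset (Fin n)) :
    ext (firstTarget n hm) (mcz C) =
      controlled (C.map Function.Embedding.inl) (Sum.inr ⟨0, hm⟩) pauliZ := by
  rw [mcz, ext_controlled, Finset.map_map]
  rfl

end Targets

/-! ### Trees of CNOT gates -/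

section Fan

variable {Q : Type}

/-- The targets of `pairs`, and the last qubit if it has no partner. -/
def evens : List Q → List Q
  | a :: _ :: ts => a :: evens ts
  | ts => ts

theorem evens_sublist : ∀ ts : List Q, (evens ts).Sublist ts
  | [] => List.Sublist.refl _
  | [_] => List.Sublist.refl _
  | a :: b :: ts => ((evens_sublist ts).cons b).cons_cons a

theorem evens_take_one (ts : List Q) : (evens ts).take 1 = ts.take 1 := by
  match ts with
  | [] => rfl
  | [_] => rfl
  | a :: b :: ts => rfl

theorem length_evens : ∀ ts : List Q, (evens ts).length = (ts.length + 1) / 2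
  | [] => by simp [evens]
  | [_] => by simp [evens]
  | a :: b :: ts => by simp only [evens, List.length_cons, length_evens ts]; omega

variable [DecidableEq Q]

/-- CNOT gates from the second to the first, from the fourth to the third qubit of a list, etc. -/
def pairs : List Q → Circuit Q
  | a :: b :: ts => cx b a ++ pairs ts
  | _ => []

/-- A binary tree of CNOT gates with `k` layers that adds all the bits of a list of at most `2 ^ k`
qubits to the first of them. -/
def fanIn : ℕ → List Q → Circuit Q
  | 0, _ => []
  | k + 1, ts => pairs ts ++ fanIn k (evens ts)

theorem count_pairs (k : Kind) : ∀ ts : List Q, ts.Nodup →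
    count k (pairs ts) = ts.length / 2 * wt k .cnot
  | [], _ => by simp [pairs, count_nil]
  | [_], _ => by simp [pairs, count_nil]
  | a :: b :: ts, h => by
    have hne : b ≠ a := fun e => by simp [e] at h
    have h' : ts.Nodup := (List.nodup_cons.1 (List.nodup_cons.1 h).2).2
    have e : (ts.length + 1 + 1) / 2 = ts.length / 2 + 1 := by omega
    simp only [pairs, count_append, cx_of_ne hne, count_cons, count_nil, count_pairs k ts h',
      Gate.kind, List.length_cons, e]
    ring

theorem count_fanIn (k : Kind) (r : ℕ) : ∀ ts : List Q, ts.Nodup → ts.length ≤ 2 ^ r →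
    count k (fanIn r ts) = (ts.length - 1) * wt k .cnot := by
  induction r with
  | zero =>
    intro ts _ hl
    have : ts.length - 1 = 0 := by simp at hl; omega
    simp [fanIn, count_nil, this]
  | succ r ih =>
    intro ts h hl
    rw [fanIn, count_append, count_pairs k ts h, ih _ ((evens_sublist ts).nodup h)
      (by rw [length_evens]; rw [pow_succ] at hl; omega), length_evens, ← add_mul]
    congr 1; omega

/-- The circuit raises the levels of the qubits in `ts` by at most `w`, relative to a common bound,
and does not change the levels of the other qubits. -/
def Raises (k : Kind) (c : Circuit Q) (ts : List Q) (w : ℕ) : Prop :=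
  ∀ (lev : Q → ℕ) (B : ℕ), (∀ q ∈ ts, lev q ≤ B) →
    (∀ q ∈ ts, levels k c lev q ≤ B + w) ∧ ∀ q ∉ ts, levels k c lev q = lev q

theorem Raises.subset {k : Kind} {c : Circuit Q} {s t : List Q} {w : ℕ} (h : Raises k c s w)
    (hst : ∀ q ∈ s, q ∈ t) : Raises k c t w := by
  intro lev B hB
  obtain ⟨h1, h2⟩ := h lev B (fun q hq => hB q (hst q hq))
  refine ⟨fun q hq => ?_, fun q hq => h2 q (fun hs => hq (hst q hs))⟩
  by_cases hs : q ∈ s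
  · exact h1 q hs
  · rw [h2 q hs]; have := hB q hq; omega

theorem Raises.append {k : Kind} {c d : Circuit Q} {t : List Q} {u v : ℕ} (hc : Raises k c t u)
    (hd : Raises k d t v) : Raises k (c ++ d) t (u + v) := by
  intro lev B hB
  obtain ⟨h1, h2⟩ := hc lev B hB
  obtain ⟨h3, h4⟩ := hd _ _ h1
  rw [levels_append, ← add_assoc]
  exact ⟨h3, fun q hq => by rw [h4 q hq, h2 q hq]⟩

theorem Raises.append_of_disjoint {k : Kind} {c d : Circuit Q} {s t : List Q} {w : ℕ}
    (hc : Raises k c s w) (hd : Raises k d t w) (hst : ∀ q ∈ s, q ∉ t) :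
    Raises k (c ++ d) (s ++ t) w := by
  intro lev B hB
  obtain ⟨h1, h2⟩ := hc lev B (fun q hq => hB q (List.mem_append_left _ hq))
  have ht : ∀ q ∈ t, levels k c lev q ≤ B := fun q hq => by
    rw [h2 q (fun hs => hst q hs hq)]; exact hB q (List.mem_append_right _ hq)
  obtain ⟨h3, h4⟩ := hd _ B ht
  rw [levels_append]
  refine ⟨fun q hq => ?_, fun q hq => ?_⟩
  · by_cases hqt : q ∈ t
    · exact h3 q hqt
    · rw [h4 q hqt]; exact h1 q ((List.mem_append.1 hq).resolve_right hqt)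
  · rw [List.mem_append, not_or] at hq
    rw [h4 q hq.2, h2 q hq.1]

theorem raises_nil (k : Kind) (ts : List Q) (w : ℕ) : Raises k ([] : Circuit Q) ts w :=
  fun _ _ hB => ⟨fun q hq => (hB q hq).trans (Nat.le_add_right _ _), fun _ _ => rfl⟩

theorem raises_cx (k : Kind) {a b : Q} (h : b ≠ a) : Raises k (cx b a) [a, b] (wt k .cnot) := by
  intro lev B hB
  simp only [List.mem_cons, List.not_mem_nil, or_false, forall_eq_or_imp, forall_eq, not_or,
    cx_of_ne h, levels_cons, levels_nil, stepLevel_cnot, or_true, true_or, if_true] at hB ⊢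
  refine ⟨⟨by omega, by omega⟩, fun q hq => ?_⟩
  rw [if_neg]; tauto

theorem raises_pairs (k : Kind) : ∀ ts : List Q, ts.Nodup →
    Raises k (pairs ts) ts (wt k .cnot) ∧ Raises k (pairs ts).reverse ts (wt k .cnot)
  | [], _ => ⟨raises_nil _ _ _, raises_nil _ _ _⟩
  | [_], _ => ⟨raises_nil _ _ _, raises_nil _ _ _⟩
  | a :: b :: ts, h => by
    simp only [List.nodup_cons, List.mem_cons, not_or] at h
    obtain ⟨⟨h1, h2⟩, h3, h4⟩ := h
    obtain ⟨r1, r2⟩ := raises_pairs k ts h4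
    have r0 := raises_cx k (a := a) (b := b) (Ne.symm h1)
    have e : (pairs (a :: b :: ts)).reverse = (pairs ts).reverse ++ cx b a := by
      rw [pairs, List.reverse_append, cx_of_ne (Ne.symm h1)]; rfl
    rw [e]
    refine ⟨r0.append_of_disjoint r1 (by simp [h2, h3]), ?_⟩
    refine (r2.append_of_disjoint r0 ?_).subset (by simp; tauto)
    intro q hq hq'
    simp only [List.mem_cons, List.not_mem_nil, or_false] at hq'
    rcases hq' with rfl | rfl
    · exact h2 hq
    · exact h3 hq

theorem raises_fanIn (k : Kind) (r : ℕ) : ∀ ts : List Q, ts.Nodup →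
    Raises k (fanIn r ts) ts (r * wt k .cnot) ∧
      Raises k (fanIn r ts).reverse ts (r * wt k .cnot) := by
  induction r with
  | zero => exact fun ts _ => ⟨raises_nil _ _ _, raises_nil _ _ _⟩
  | succ r ih =>
    intro ts h
    obtain ⟨h1, h2⟩ := raises_pairs k ts h
    obtain ⟨h3, h4⟩ := ih (evens ts) ((evens_sublist ts).nodup h)
    have hsub := fun q hq => (evens_sublist ts).subset (a := q) hq
    rw [fanIn, List.reverse_append, Nat.succ_mul]
    refine ⟨?_, (h4.subset hsub).append h2⟩
    rw [add_comm]
    exact h1.append (h3.subset hsub)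

theorem mem_fanIn (r : ℕ) : ∀ (ts : List Q) (g : Gate Q), g ∈ fanIn r ts →
    ∃ (b a : Q) (h : b ≠ a), b ∈ ts ∧ a ∈ ts ∧ g = .CNOT b a h := by
  have hp : ∀ (ts : List Q) (g : Gate Q), g ∈ pairs ts →
      ∃ (b a : Q) (h : b ≠ a), b ∈ ts ∧ a ∈ ts ∧ g = .CNOT b a h := by
    intro ts
    induction ts using pairs.induct with
    | case1 a b ts ih =>
      intro g hg
      rw [pairs, List.mem_append] at hg
      rcases hg with hg | hg
      · by_cases hne : b ≠ a
        · rw [cx_of_ne hne, List.mem_singleton] at hg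
          exact ⟨b, a, hne, by simp, by simp, hg⟩
        · simp [cx, hne] at hg
      · obtain ⟨b', a', h, hb, ha, e⟩ := ih g hg
        exact ⟨b', a', h, by simp [hb], by simp [ha], e⟩
    | case2 ts hts =>
      intro g hg
      rw [pairs] at hg
      · simp at hg
      · exact hts
  induction r with
  | zero => intro ts g hg; simp [fanIn] at hg
  | succ r ih =>
    intro ts g hg
    rw [fanIn, List.mem_append] at hg
    rcases hg with hg | hg
    · exact hp ts g hg
    · obtain ⟨b, a, h, hb, ha, e⟩ := ih _ g hg
      exact ⟨b, a, h, (evens_sublist ts).subset hb, (evens_sublist ts).subset ha, e⟩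

/-- The sign of the gate that applies `Z` to all qubits of `l`, controlled by the qubits of `C`. -/
def parity (C : Finset Q) (l : List Q) (x : Q → Fin 2) : ℂ :=
  if ∀ c ∈ C, x c = 1 then (l.map fun q => if x q = 1 then (-1 : ℂ) else 1).prod else 1

/-- Adding the bit of `b` to that of `a` adds `b` to the qubits whose parity is taken. -/
theorem parity_flip (C : Finset Q) (l₁ l₂ : List Q) (a b : Q) (haC : a ∉ C) (h₁ : a ∉ l₁)
    (h₂ : a ∉ l₂) (x : Q → Fin 2) :
    parity C (l₁ ++ a :: l₂) (flipIf (fun x => x b = 1) a x) = parity C (l₁ ++ a :: b :: l₂) x := by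
  have hC : (∀ c ∈ C, flipIf (fun x => x b = 1) a x c = 1) ↔ ∀ c ∈ C, x c = 1 :=
    forall_congr' fun c => forall_congr' fun hc => by
      rw [flipIf_of_ne _ (fun e : c = a => haC (e ▸ hc))]
  have hl : ∀ l : List Q, a ∉ l →
      l.map (fun q => if flipIf (fun x => x b = 1) a x q = 1 then (-1 : ℂ) else 1) =
      l.map fun q => if x q = 1 then (-1 : ℂ) else 1 := fun l hl =>
    List.map_congr_left fun q hq => by rw [flipIf_of_ne _ (fun e : q = a => hl (e ▸ hq))]
  simp only [parity, hC, List.map_append, List.map_cons, List.prod_append, List.prod_cons, hl _ h₁,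
    hl _ h₂, flipIf_self]
  have hxa : x a = 0 ∨ x a = 1 := by omega
  by_cases hb : x b = 1 <;> rcases hxa with ha | ha <;> simp [hb, ha]

variable [Fintype Q]

/-- One layer of the tree: a controlled `Z` on the targets of the CNOT gates becomes a controlled
`Z` on all the qubits of the list. The qubits of `l` are not touched. -/
theorem pairs_conj (C : Finset Q) : ∀ (ts l : List Q), ts.Nodup → (∀ q ∈ ts, q ∉ C) →
    (∀ q ∈ ts, q ∉ l) →
    eval (pairs ts).reverse * Matrix.diagonal (parity C (l ++ evens ts)) * eval (pairs ts) =
      Matrix.diagonal (parity C (l ++ ts))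
  | [], l, _, _, _ => by simp [pairs, evens, eval]
  | [_], l, _, _, _ => by simp [pairs, evens, eval]
  | a :: b :: ts, l, h, hC, hl => by
    simp only [List.nodup_cons, List.mem_cons, not_or] at h
    obtain ⟨⟨h1, h2⟩, h3, h4⟩ := h
    have e : (pairs (a :: b :: ts)).reverse = (pairs ts).reverse ++ cx b a := by
      rw [pairs, List.reverse_append, cx_of_ne (Ne.symm h1)]; rfl
    have ih := pairs_conj C ts (l ++ [a]) h4 (fun q hq => hC q (by simp [hq])) (fun q hq => by
      have := hl q (by simp [hq])
      simp only [List.mem_append, List.mem_singleton, not_or]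
      exact ⟨this, fun e => h2 (e ▸ hq)⟩)
    rw [e, pairs, eval_append, eval_append, evens]
    have e2 : l ++ a :: evens ts = l ++ [a] ++ evens ts := by simp
    calc _ = eval (cx b a) * (eval (pairs ts).reverse *
          Matrix.diagonal (parity C (l ++ [a] ++ evens ts)) * eval (pairs ts)) * eval (cx b a) := by
          rw [e2]; simp only [Matrix.mul_assoc]
      _ = _ := by
        rw [ih, cx_conj_diagonal b a (Ne.symm h1)]
        congr 1
        funext x
        rw [List.append_assoc]
        exact parity_flip C l ts a b (hC a (by simp)) (hl a (by simp)) h2 x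

/-- Conjugation by the tree of CNOT gates turns a controlled `Z` on the first qubit of a list into
a controlled `Z` on all of its qubits. -/
theorem fanIn_conj (C : Finset Q) (r : ℕ) : ∀ ts : List Q, ts.Nodup → (∀ q ∈ ts, q ∉ C) →
    ts.length ≤ 2 ^ r →
    eval (fanIn r ts).reverse * Matrix.diagonal (parity C (ts.take 1)) * eval (fanIn r ts) =
      Matrix.diagonal (parity C ts) := by
  induction r with
  | zero =>
    intro ts _ _ hl
    rw [pow_zero] at hl
    simp [fanIn, eval, List.take_of_length_le hl]
  | succ r ih =>
    intro ts h hC hl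
    have hsub := fun q hq => (evens_sublist ts).subset (a := q) hq
    have := ih (evens ts) ((evens_sublist ts).nodup h) (fun q hq => hC q (hsub q hq))
      (by rw [length_evens]; rw [pow_succ] at hl; omega)
    rw [evens_take_one] at this
    have hp := pairs_conj C ts [] h hC (by simp)
    rw [fanIn, List.reverse_append, eval_append, eval_append]
    simp only [List.nil_append] at hp
    rw [← hp, ← this]
    simp only [Matrix.mul_assoc]

end Fan

/-! ### Rotations and `SU(2)` -/

section SpecialUnitary

theorem exists_polar (x y : ℝ) : ∃ r θ : ℝ, 0 ≤ r ∧ r ^ 2 = x ^ 2 + y ^ 2 ∧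
    x = r * Real.cos θ ∧ y = r * Real.sin θ := by
  refine ⟨‖(⟨x, y⟩ : ℂ)‖, (⟨x, y⟩ : ℂ).arg, norm_nonneg _, ?_, ?_, ?_⟩
  · rw [Complex.sq_norm, Complex.normSq_mk]; ring
  · exact (Complex.norm_mul_cos_arg (⟨x, y⟩ : ℂ)).symm
  · exact (Complex.norm_mul_sin_arg (⟨x, y⟩ : ℂ)).symm

theorem rotZ_conj_rotX (ψ μ : ℝ) : rotZ ψ * rotX (2 * μ) * rotZ (-ψ) =
    !![(Real.cos μ : ℂ), -Complex.I * (Real.sin μ * Real.cos ψ : ℝ) - (Real.sin μ * Real.sin ψ : ℝ);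
      -Complex.I * (Real.sin μ * Real.cos ψ : ℝ) + (Real.sin μ * Real.sin ψ : ℝ),
      (Real.cos μ : ℂ)] := by
  have h1 : Complex.exp (-(Complex.I * (ψ / 2))) * Complex.exp (-(Complex.I * (ψ / 2))) =
      Complex.cos ψ - Complex.sin ψ * Complex.I := by
    rw [← Complex.exp_add, Complex.cos_sub_sin_I]; congr 1; ring
  have h2 : Complex.exp (Complex.I * (ψ / 2)) * Complex.exp (Complex.I * (ψ / 2)) =
      Complex.cos ψ + Complex.sin ψ * Complex.I := by
    rw [← Complex.exp_add, Complex.cos_add_sin_I]; congr 1; ring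
  have h3 : Complex.exp (Complex.I * (ψ / 2)) * Complex.exp (-(Complex.I * (ψ / 2))) = 1 := by
    rw [← Complex.exp_add, add_neg_cancel, Complex.exp_zero]
  have hI := Complex.I_mul_I
  ext i j
  fin_cases i <;> fin_cases j <;>
    simp [rotX, rotZ, Matrix.mul_apply, Fin.sum_univ_two, neg_div]
  · linear_combination Complex.cos μ * h3
  · linear_combination -Complex.I * Complex.sin μ * h1 + Complex.sin μ * Complex.sin ψ * hI
  · linear_combination -Complex.I * Complex.sin μ * h2 - Complex.sin μ * Complex.sin ψ * hI
  · linear_combination Complex.cos μ * h3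

theorem rotX_conj (φ : ℝ) (p u v : ℝ) :
    rotX φ * !![(p : ℂ), -Complex.I * (u : ℂ) - v; -Complex.I * u + v, (p : ℂ)] * rotX (-φ) =
    !![p - (v * Real.sin φ : ℝ) * Complex.I, -(u * Complex.I) - (v * Real.cos φ : ℝ);
      -(u * Complex.I) + (v * Real.cos φ : ℝ), p + (v * Real.sin φ : ℝ) * Complex.I] := by
  have h := Complex.cos_sq_add_sin_sq (φ / 2)
  have hc : Complex.cos φ = Complex.cos (φ / 2) ^ 2 - Complex.sin (φ / 2) ^ 2 := by
    rw [← Complex.cos_two_mul']; congr 1; ring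
  have hs : Complex.sin φ = 2 * Complex.sin (φ / 2) * Complex.cos (φ / 2) := by
    rw [← Complex.sin_two_mul]; congr 1; ring
  have hI := Complex.I_mul_I
  ext i j
  fin_cases i <;> fin_cases j <;>
    simp [rotX, Matrix.mul_apply, Fin.sum_univ_two, neg_div, hc, hs] <;>
  generalize Complex.cos (φ / 2) = C at * <;> generalize Complex.sin (φ / 2) = S at *
  · linear_combination p * h - p * S ^ 2 * hI
  · linear_combination -(u * Complex.I) * h + (u * Complex.I - v) * S ^ 2 * hI
  · linear_combination -(u * Complex.I) * h + (u * Complex.I + v) * S ^ 2 * hI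
  · linear_combination p * h - p * S ^ 2 * hI

/-- Every element of `SU(2)` is a rotation about an axis that is taken to the x axis by a rotation
about the x axis followed by one about the z axis. -/
theorem exists_euler (W : Matrix (Fin 2) (Fin 2) ℂ)
    (hW : W ∈ Matrix.specialUnitaryGroup (Fin 2) ℂ) :
    ∃ lam θ₁ θ₂ : ℝ,
      W = rotX (-θ₁) * rotZ (-θ₂) * rotX lam * rotZ θ₂ * rotX θ₁ := by
  rw [Matrix.mem_specialUnitaryGroup_iff, Matrix.mem_unitaryGroup_iff] at hW
  obtain ⟨hU, hdet⟩ := hW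
  -- the inverse of `W` is its adjugate, which gives the relations between its entries
  have hstar : star W = W.adjugate := by
    have h1 : W * W.adjugate = 1 := by rw [Matrix.mul_adjugate, hdet, one_smul]
    calc star W = star W * (W * W.adjugate) := by rw [h1, Matrix.mul_one]
      _ = (star W * W) * W.adjugate := by rw [Matrix.mul_assoc]
      _ = W.adjugate := by rw [mul_eq_one_comm.1 hU, Matrix.one_mul]
  rw [Matrix.adjugate_fin_two] at hstar
  have e1 : W 1 1 = star (W 0 0) := by
    have := congrFun (congrFun hstar 0) 0
    simpa [Matrix.star_apply] using this.symm
  have e2 : W 1 0 = -star (W 0 1) := by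
    have := congrFun (congrFun hstar 1) 0
    simp [Matrix.star_apply] at this
    simp [this]
  rw [Matrix.det_fin_two, e1, e2] at hdet
  obtain ⟨a, b, h00⟩ : ∃ a b : ℝ, W 0 0 = a - b * Complex.I :=
    ⟨(W 0 0).re, -(W 0 0).im, by simp [Complex.re_add_im]⟩
  obtain ⟨c, d, h01⟩ : ∃ c d : ℝ, W 0 1 = -(c * Complex.I) - d :=
    ⟨-(W 0 1).im, -(W 0 1).re, by
      apply Complex.ext <;> simp⟩
  have hnorm : a ^ 2 + b ^ 2 + c ^ 2 + d ^ 2 = 1 := by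
    have h := congrArg Complex.re hdet
    simp [h00, h01] at h
    nlinarith [h]
  -- `W = a - i (c X + d Y + b Z)`; spherical coordinates for `(a, c, d, b)`
  obtain ⟨r₁, φ, hr₁, hr₁', hd, hb⟩ := exists_polar d b
  obtain ⟨r₂, ψ, hr₂, hr₂', hc, hs⟩ := exists_polar c r₁
  obtain ⟨r₃, μ, hr₃, hr₃', ha, hs'⟩ := exists_polar a r₂
  have hr : r₃ = 1 := by
    have : r₃ ^ 2 = 1 := by rw [hr₃', hr₂', hr₁']; linarith
    nlinarith
  subst hr
  refine ⟨2 * μ, -φ, -ψ, ?_⟩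
  have h10 : W 1 0 = -(c * Complex.I) + d := by rw [e2, h01]; simp; ring
  have h11 : W 1 1 = a + b * Complex.I := by rw [e1, h00]; simp
  rw [neg_neg, neg_neg, Matrix.mul_assoc (rotX φ), Matrix.mul_assoc (rotX φ), rotZ_conj_rotX,
    rotX_conj, Matrix.eta_fin_two W, h00, h01, h10, h11, hb, hd, hs, hc, hs', ha]
  simp only [one_mul]

end SpecialUnitary

/-! ### The multi-target circuit -/

section FanOut

variable {n m : ℕ}

/-- The list of all targets. -/
def targets (n m : ℕ) : List (Fin n ⊕ Fin m) := (List.finRange m).map Sum.inr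

theorem targets_nodup (n m : ℕ) : (targets n m).Nodup :=
  (List.nodup_finRange m).map Sum.inr_injective

theorem targets_length (n m : ℕ) : (targets n m).length = m := by simp [targets]

theorem targets_take_one (hm : 0 < m) : (targets n m).take 1 = [Sum.inr ⟨0, hm⟩] := by
  obtain ⟨m, rfl⟩ : ∃ m', m = m' + 1 := ⟨m - 1, by omega⟩
  simp [targets, List.finRange_succ]

/-- The tree of CNOT gates on all targets. -/
def fan (n m : ℕ) : Circuit (Fin n ⊕ Fin m) := fanIn (Nat.clog 2 m) (targets n m)

/-- A block for the first target, extended to all targets by conjugation with CNOT gates. -/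
def fanned (hm : 0 < m) (U : Circuit (Fin n ⊕ Fin 1)) : Circuit (Fin n ⊕ Fin m) :=
  fan n m ++ U.map (Gate.map (firstTarget n hm)) ++ (fan n m).reverse

theorem controlled_inr_inr (C : Finset (Fin m)) (j : Fin m) (M : Matrix (Fin 2) (Fin 2) ℂ) :
    (controlled (C.map Function.Embedding.inr) (Sum.inr j) M : Op (Fin n ⊕ Fin m)) =
      tgt (controlled C j M) := by
  funext x y
  have e : (∀ q, q ≠ Sum.inr j → x q = y q) ↔
      x ∘ Sum.inl = y ∘ Sum.inl ∧ ∀ j', j' ≠ j → x (Sum.inr j') = y (Sum.inr j') := by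
    simp [funext_iff]
  have e2 : (∀ q ∈ C.map Function.Embedding.inr, y q = 1) ↔ ∀ i ∈ C, y (Sum.inr i) = 1 := by simp
  simp only [controlled, tgt, e, e2, Function.comp_apply]
  split_ifs <;> first | rfl | tauto

theorem commute_ctl_eval (V : Op (Fin n)) (c : Circuit (Fin n ⊕ Fin m))
    (hc : ∀ g ∈ c, ∃ (b a : Fin n ⊕ Fin m) (h : b ≠ a),
      b ∈ targets n m ∧ a ∈ targets n m ∧ g = .CNOT b a h) : Commute (ctl V) (eval c) := by
  induction c with
  | nil => exact Commute.one_right _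
  | cons g c ih =>
    refine (ih fun g hg => hc g (List.mem_cons_of_mem _ hg)).mul_right ?_
    obtain ⟨b, a, h, hb, ha, rfl⟩ := hc g List.mem_cons_self
    simp only [targets, List.mem_map, List.mem_finRange, true_and] at hb ha
    obtain ⟨b, rfl⟩ := hb
    obtain ⟨a, rfl⟩ := ha
    have := controlled_inr_inr (n := n) {b} a pauliX
    rw [Finset.map_singleton] at this
    rw [Gate.toOp]
    exact this ▸ commute_ctl_tgt V _

theorem multiZ_eq_parity (C : Finset (Fin n)) :
    multiZ C = Matrix.diagonal (parity (C.map Function.Embedding.inl) (targets n m)) := by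
  funext x y
  have e : (∀ q ∈ C.map Function.Embedding.inl, x q = 1) ↔ ∀ i ∈ C, (x ∘ Sum.inl) i = 1 := by simp
  have hz : ∀ u v : Fin 2, pauliZ u v = if u = v then (if u = 1 then (-1 : ℂ) else 1) else 0 := by
    intro u v; fin_cases u <;> fin_cases v <;> simp [pauliZ]
  simp only [multiZ, pop, Matrix.diagonal_apply, parity, e, basis_ext (x := x) (y := y)]
  have hp : ((targets n m).map fun q => if x q = 1 then (-1 : ℂ) else 1).prod =
      ∏ j : Fin m, if x (Sum.inr j) = 1 then (-1 : ℂ) else 1 := by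
    rw [targets, List.map_map, ← List.ofFn_eq_map, List.prod_ofFn]; rfl
  rw [hp]
  by_cases h : x ∘ Sum.inl = y ∘ Sum.inl
  · by_cases h' : ∀ j, x (Sum.inr j) = y (Sum.inr j)
    · have h'' : x ∘ Sum.inr = y ∘ Sum.inr := funext h'
      rw [if_pos h, if_pos (And.intro h h'')]
      split_ifs
      · exact Finset.prod_congr rfl fun j _ => by rw [hz, if_pos (h' j)]
      · exact Finset.prod_eq_one fun j _ => by rw [Matrix.one_apply, if_pos (h' j)]
    · have h'' : ¬ x ∘ Sum.inr = y ∘ Sum.inr := fun e => h' (congrFun e)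
      rw [if_pos h, if_neg (fun e : _ ∧ _ => h'' e.2)]
      push Not at h'
      obtain ⟨j, hj⟩ := h'
      refine Finset.prod_eq_zero (Finset.mem_univ j) ?_
      split_ifs
      · rw [hz, if_neg hj]
      · rw [Matrix.one_apply, if_neg hj]
  · rw [if_neg h, if_neg (fun e : _ ∧ _ => h e.1)]

/-- The circuit `fanned` turns the `Z` on the first target into a `Z` on all targets. The operators
on the controls, which the block may contain as well, commute with the tree of CNOT gates. -/
theorem eval_fanned (hm : 0 < m) (U : Circuit (Fin n ⊕ Fin 1)) (C : Finset (Fin n))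
    (A B : Op (Fin n)) (hU : eval U = onControls A * mcz C * onControls B) :
    eval (fanned hm U) = ctl A * multiZ C * ctl B := by
  have hfan := mem_fanIn (Nat.clog 2 m) (targets n m)
  have c₁ := commute_ctl_eval B (fan n m) hfan
  have c₂ := commute_ctl_eval A (fan n m).reverse (fun g hg => hfan g (List.mem_reverse.1 hg))
  have hconj := fanIn_conj (C.map Function.Embedding.inl) (Nat.clog 2 m) (targets n m)
    (targets_nodup n m) (by simp [targets]) (by
      rw [targets_length]; exact Nat.le_pow_clog (by norm_num) m)
  have hZ : controlled (C.map Function.Embedding.inl) (Sum.inr ⟨0, hm⟩) pauliZ =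
      Matrix.diagonal (parity (C.map Function.Embedding.inl) ((targets n m).take 1)) := by
    rw [targets_take_one hm, controlled_pauliZ]
    congr 1
    funext x
    by_cases h : x (Sum.inr ⟨0, hm⟩) = 1 <;> simp [parity, h]
  rw [fanned, eval_append, eval_append, eval_map, hU, ext_mul, ext_mul, ext_onControls,
    ext_onControls, ext_mcz, hZ, multiZ_eq_parity, ← hconj]
  change eval (fan n m).reverse * (ctl A * Matrix.diagonal (parity _ _) * ctl B * eval (fan n m)) =
    ctl A * (eval (fan n m).reverse * Matrix.diagonal (parity _ _) * eval (fan n m)) * ctl B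
  generalize Matrix.diagonal (parity (C.map Function.Embedding.inl) ((targets n m).take 1)) = Z
  calc _ = (eval (fan n m).reverse * ctl A) * Z * (ctl B * eval (fan n m)) := by
        simp only [Matrix.mul_assoc]
    _ = _ := by rw [c₁.eq, ← c₂.eq]; simp only [Matrix.mul_assoc]

/-- The multi-target circuit: every block is extended to all targets, and every rotation is replaced
by a layer of rotations. -/
noncomputable def multiCircuit (hm : 0 < m) (U₁ U₂ U₃ U₄ : Circuit (Fin n ⊕ Fin 1))
    (lam θ₁ θ₂ : Fin m → ℝ) : Circuit (Fin n ⊕ Fin m) :=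
  (List.finRange m).map (fun j => .Rx (θ₁ j) (Sum.inr j)) ++
  (List.finRange m).map (fun j => .Rz (θ₂ j) (Sum.inr j)) ++ fanned hm U₁ ++
  (List.finRange m).map (fun j => .Rx (-(lam j / 4)) (Sum.inr j)) ++ fanned hm U₂ ++
  (List.finRange m).map (fun j => .Rx (lam j / 4) (Sum.inr j)) ++ fanned hm U₃ ++
  (List.finRange m).map (fun j => .Rx (-(lam j / 4)) (Sum.inr j)) ++ fanned hm U₄ ++
  (List.finRange m).map (fun j => .Rx (lam j / 4) (Sum.inr j)) ++
  (List.finRange m).map (fun j => .Rz (-θ₂ j) (Sum.inr j)) ++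
  (List.finRange m).map (fun j => .Rx (-θ₁ j) (Sum.inr j))

theorem count_layer (k : Kind) (g : Fin m → Gate (Fin n ⊕ Fin m)) (hg : ∀ j, (g j).kind = .rot) :
    count k ((List.finRange m).map g) = m * wt k .rot := by
  have : ∀ l : List (Fin m), count k (l.map g) = l.length * wt k .rot := by
    intro l
    induction l with
    | nil => simp [count_nil]
    | cons j l ih => rw [List.map_cons, count_cons, ih, hg, List.length_cons]; ring
  simpa using this (List.finRange m)

theorem count_reverse {Q : Type} (k : Kind) (c : Circuit Q) : count k c.reverse = count k c := by
  simp [count]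

theorem count_fanned (hm : 0 < m) (k : Kind) (U : Circuit (Fin n ⊕ Fin 1)) :
    count k (fanned hm U) = count k U + 2 * (m - 1) * wt k .cnot := by
  have h : count k (fan n m) = (m - 1) * wt k .cnot := by
    rw [fan, count_fanIn k _ _ (targets_nodup n m), targets_length]
    rw [targets_length]; exact Nat.le_pow_clog (by norm_num) m
  rw [fanned, count_append, count_append, count_reverse, count_map, h]
  ring

theorem count_multiCircuit (hm : 0 < m) (k : Kind) (U₁ U₂ U₃ U₄ : Circuit (Fin n ⊕ Fin 1))
    (lam θ₁ θ₂ : Fin m → ℝ) (lam' θ₁' θ₂' : ℝ) :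
    count k (multiCircuit hm U₁ U₂ U₃ U₄ lam θ₁ θ₂) =
      count k (macroCircuit U₁ U₂ U₃ U₄ lam' θ₁' θ₂') + 8 * (m - 1) * wt k .rot +
        8 * (m - 1) * wt k .cnot := by
  obtain ⟨m, rfl⟩ : ∃ m', m = m' + 1 := ⟨m - 1, by omega⟩
  have hx : ∀ f : Fin (m + 1) → ℝ, count k ((List.finRange (m + 1)).map
      (fun j => (Gate.Rx (f j) (Sum.inr j) : Gate (Fin n ⊕ Fin (m + 1))))) =
      (m + 1) * wt k .rot := fun f => count_layer k _ (fun _ => rfl)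
  have hz : ∀ f : Fin (m + 1) → ℝ, count k ((List.finRange (m + 1)).map
      (fun j => (Gate.Rz (f j) (Sum.inr j) : Gate (Fin n ⊕ Fin (m + 1))))) =
      (m + 1) * wt k .rot := fun f => count_layer k _ (fun _ => rfl)
  simp only [multiCircuit, macroCircuit, count_append, count_fanned, count_cons, count_nil]
  simp only [hx, hz, Gate.kind, Nat.add_sub_cancel]
  ring

/-- The levels `lev'` on the register with all targets are larger by at most `o` than the levels
`lev` on the register with a single target. -/
def Simulates (o : ℕ) (lev : Fin n ⊕ Fin 1 → ℕ) (lev' : Fin n ⊕ Fin m → ℕ) : Prop :=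
  (∀ i, lev' (Sum.inl i) ≤ lev (Sum.inl i) + o) ∧ ∀ j, lev' (Sum.inr j) ≤ lev (Sum.inr 0) + o

theorem le_stepLevel {Q : Type} [DecidableEq Q] (k : Kind) (lev : Q → ℕ) (g : Gate Q) (q : Q) :
    lev q ≤ stepLevel k lev g q := by
  unfold stepLevel
  split_ifs with h
  · exact (Finset.le_sup h).trans (Nat.le_add_right _ _)
  · exact (Finset.le_sup h).trans (Nat.le_add_right _ _)
  · exact le_rfl

theorem stepLevel_map_le {Q Q' : Type} [DecidableEq Q] [DecidableEq Q'] (k : Kind) (ι : Q ↪ Q')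
    (o : ℕ) (lev : Q → ℕ) (lev' : Q' → ℕ) (h : ∀ p, lev' (ι p) ≤ lev p + o) (g : Gate Q) (p : Q) :
    stepLevel k lev' (g.map ι) (ι p) ≤ stepLevel k lev g p + o := by
  simp only [stepLevel, Gate.support_map, Finset.mem_map', Gate.map_kind, Finset.sup_map]
  by_cases hp : p ∈ g.support
  · rw [if_pos hp, if_pos hp]
    have : g.support.sup (lev' ∘ ι) ≤ g.support.sup lev + o :=
      Finset.sup_le fun q hq => (h q).trans (Nat.add_le_add_right (Finset.le_sup hq) o)
    omega
  · rw [if_neg hp, if_neg hp]; exact h p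

/-- Gates on the first target preserve the comparison with a single target. -/
theorem Simulates.map {k : Kind} {o : ℕ} (hm : 0 < m) (U : Circuit (Fin n ⊕ Fin 1)) :
    ∀ {lev : Fin n ⊕ Fin 1 → ℕ} {lev' : Fin n ⊕ Fin m → ℕ}, Simulates o lev lev' →
    Simulates o (levels k U lev) (levels k (U.map (Gate.map (firstTarget n hm))) lev') := by
  induction U with
  | nil => exact fun h => h
  | cons g U ih =>
    intro lev lev' h
    rw [List.map_cons, levels_cons, levels_cons]
    refine ih ?_
    have hι : ∀ p, lev' (firstTarget n hm p) ≤ lev p + o := by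
      rintro (i | i)
      · exact h.1 i
      · rw [Subsingleton.elim i 0]; exact h.2 _
    have hs := stepLevel_map_le k (firstTarget n hm) o lev lev' hι g
    refine ⟨fun i => hs (Sum.inl i), fun j => ?_⟩
    by_cases hj : j = ⟨0, hm⟩
    · subst hj; exact hs (Sum.inr 0)
    -- the gate does not touch the other targets, and the level of the single target may only grow
    · have hns : Sum.inr j ∉ (g.map (firstTarget n hm)).support := by
        rw [Gate.support_map, Finset.mem_map]
        rintro ⟨(i | i), -, hi⟩
        · simp [firstTarget_inl] at hi
        · rw [firstTarget_inr, Sum.inr.injEq] at hi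
          exact hj hi.symm
      rw [stepLevel, if_neg hns]
      exact (h.2 j).trans (Nat.add_le_add_right (le_stepLevel k lev g _) o)

theorem Simulates.raise {k : Kind} {o w : ℕ} {lev : Fin n ⊕ Fin 1 → ℕ} {lev' : Fin n ⊕ Fin m → ℕ}
    (h : Simulates o lev lev') {c : Circuit (Fin n ⊕ Fin m)} (hc : Raises k c (targets n m) w) :
    Simulates (o + w) lev (levels k c lev') := by
  obtain ⟨h1, h2⟩ := hc lev' (lev (Sum.inr 0) + o) (by
    intro q hq
    simp only [targets, List.mem_map, List.mem_finRange, true_and] at hq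
    obtain ⟨j, rfl⟩ := hq
    exact h.2 j)
  refine ⟨fun i => ?_, fun j => ?_⟩
  · rw [h2 _ (by simp [targets])]
    have := h.1 i; omega
  · rw [← add_assoc]; exact h1 _ (by simp [targets])

theorem Simulates.fanned {k : Kind} {o : ℕ} (hm : 0 < m) {lev : Fin n ⊕ Fin 1 → ℕ}
    {lev' : Fin n ⊕ Fin m → ℕ} (h : Simulates o lev lev') (U : Circuit (Fin n ⊕ Fin 1)) :
    Simulates (o + 2 * (Nat.clog 2 m * wt k .cnot)) (levels k U lev)
      (levels k (fanned hm U) lev') := by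
  obtain ⟨r1, r2⟩ := raises_fanIn k (Nat.clog 2 m) (targets n m) (targets_nodup n m)
  have := ((h.raise r1).map (k := k) hm U).raise r2
  rw [QCircuit.fanned, levels_append, levels_append, two_mul, ← add_assoc]
  exact this

theorem stepLevel_of_kind_ne {Q : Type} [DecidableEq Q] {k : Kind} (lev : Q → ℕ) {g : Gate Q}
    {q : Q} (hs : g.support = {q}) (hk : g.kind ≠ k) : stepLevel k lev g = lev := by
  rw [stepLevel_of_support_eq k lev hs, wt, if_neg hk, add_zero, Function.update_eq_self]

theorem levels_layer {k : Kind} (hk : k ≠ .rot) (g : Fin m → Gate (Fin n ⊕ Fin m))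
    (hg : ∀ j, (g j).kind = .rot) (hs : ∀ j, (g j).support = {Sum.inr j})
    (lev : Fin n ⊕ Fin m → ℕ) : levels k ((List.finRange m).map g) lev = lev := by
  have : ∀ l : List (Fin m), levels k (l.map g) lev = lev := by
    intro l
    induction l with
    | nil => rfl
    | cons j l ih =>
      rw [List.map_cons, levels_cons, stepLevel_of_kind_ne lev (hs j) (by rw [hg]; exact hk.symm),
        ih]
  exact this _

theorem levels_macroCircuit {k : Kind} (hk : k ≠ .rot) (U₁ U₂ U₃ U₄ : Circuit (Fin n ⊕ Fin 1))
    (lam θ₁ θ₂ : ℝ) (lev : Fin n ⊕ Fin 1 → ℕ) :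
    levels k (macroCircuit U₁ U₂ U₃ U₄ lam θ₁ θ₂) lev =
      levels k U₄ (levels k U₃ (levels k U₂ (levels k U₁ lev))) := by
  have hx : ∀ θ (l : Fin n ⊕ Fin 1 → ℕ), stepLevel k l (.Rx θ (Sum.inr 0)) = l :=
    fun θ l => stepLevel_of_kind_ne l rfl hk.symm
  have hz : ∀ θ (l : Fin n ⊕ Fin 1 → ℕ), stepLevel k l (.Rz θ (Sum.inr 0)) = l :=
    fun θ l => stepLevel_of_kind_ne l rfl hk.symm
  simp only [macroCircuit, levels_append, levels_cons, levels_nil, hx, hz]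

/-- Layers of rotations do not change the levels, so that only the eight trees add to the depth. -/
theorem depth_multiCircuit (hm : 0 < m) {k : Kind} (hk : k ≠ .rot)
    (U₁ U₂ U₃ U₄ : Circuit (Fin n ⊕ Fin 1)) (lam θ₁ θ₂ : Fin m → ℝ) (lam' θ₁' θ₂' : ℝ) :
    depth k (multiCircuit hm U₁ U₂ U₃ U₄ lam θ₁ θ₂) ≤
      depth k (macroCircuit U₁ U₂ U₃ U₄ lam' θ₁' θ₂') + 8 * (Nat.clog 2 m * wt k .cnot) := by
  have h0 : Simulates (n := n) (m := m) 0 (fun _ => 0) (fun _ => 0) :=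
    ⟨fun _ => le_rfl, fun _ => le_rfl⟩
  have hsim := (((h0.fanned (k := k) hm U₁).fanned (k := k) hm U₂).fanned (k := k) hm U₃).fanned
    (k := k) hm U₄
  have hl' := levels_macroCircuit hk U₁ U₂ U₃ U₄ lam' θ₁' θ₂' (fun _ => 0)
  have hl : levels k (multiCircuit hm U₁ U₂ U₃ U₄ lam θ₁ θ₂) (fun _ => 0) =
      levels k (QCircuit.fanned hm U₄) (levels k (QCircuit.fanned hm U₃)
        (levels k (QCircuit.fanned hm U₂) (levels k (QCircuit.fanned hm U₁) (fun _ => 0)))) := by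
    have hx : ∀ (f : Fin m → ℝ) (l : Fin n ⊕ Fin m → ℕ), levels k ((List.finRange m).map
        (fun j => (Gate.Rx (f j) (Sum.inr j) : Gate (Fin n ⊕ Fin m)))) l = l :=
      fun f l => levels_layer hk _ (fun _ => rfl) (fun _ => rfl) l
    have hz : ∀ (f : Fin m → ℝ) (l : Fin n ⊕ Fin m → ℕ), levels k ((List.finRange m).map
        (fun j => (Gate.Rz (f j) (Sum.inr j) : Gate (Fin n ⊕ Fin m)))) l = l :=
      fun f l => levels_layer hk _ (fun _ => rfl) (fun _ => rfl) l
    simp only [multiCircuit, levels_append, hx, hz]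
  rw [← hl, ← hl'] at hsim
  have hle : ∀ p, levels k (macroCircuit U₁ U₂ U₃ U₄ lam' θ₁' θ₂') (fun _ => 0) p ≤
      depth k (macroCircuit U₁ U₂ U₃ U₄ lam' θ₁' θ₂') := fun p =>
    Finset.le_sup (f := levels k (macroCircuit U₁ U₂ U₃ U₄ lam' θ₁' θ₂') (fun _ => 0))
      (Finset.mem_univ p)
  refine Finset.sup_le fun q _ => ?_
  rcases q with i | j
  · have h1 := hsim.1 i
    have h2 := hle (Sum.inl i)
    exact h1.trans (by omega)
  · have h1 := hsim.2 j
    have h2 := hle (Sum.inr 0)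
    exact h1.trans (by omega)

theorem conjTranspose_mul_of_mem {V : Op (Fin n)}
    (h : V ∈ Matrix.unitaryGroup (Fin n → Fin 2) ℂ) : Vᴴ * V = 1 :=
  Matrix.mem_unitaryGroup_iff'.1 h

theorem eval_multiCircuit (hm : 0 < m) {C₁ C₂ : Finset (Fin n)} (hC : C₁ ∪ C₂ = Finset.univ)
    {δ₁ δ₂ : (Fin n → Fin 2) → ℂ} (hδ₁ : ∀ x, ‖δ₁ x‖ = 1) (hδ₂ : ∀ x, ‖δ₂ x‖ = 1)
    {V₁ V₂ V₃ : Op (Fin n)} (h₁ : V₁ ∈ Matrix.unitaryGroup (Fin n → Fin 2) ℂ)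
    (h₂ : V₂ ∈ Matrix.unitaryGroup (Fin n → Fin 2) ℂ)
    (h₃ : V₃ ∈ Matrix.unitaryGroup (Fin n → Fin 2) ℂ) {U₁ U₂ U₃ U₄ : Circuit (Fin n ⊕ Fin 1)}
    (hU₁ : eval U₁ = onControls V₁ * (onControls (Matrix.diagonal δ₁) * mcz C₁))
    (hU₂ : eval U₂ = onControls V₂ * (onControls (Matrix.diagonal δ₂) * mcz C₂) * onControls V₁ᴴ)
    (hU₃ : eval U₃ = onControls V₃ * (onControls (Matrix.diagonal δ₁)ᴴ * mcz C₁) * onControls V₂ᴴ)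
    (hU₄ : eval U₄ = onControls (Matrix.diagonal δ₂)ᴴ * mcz C₂ * onControls V₃ᴴ)
    (lam θ₁ θ₂ : Fin m → ℝ) :
    eval (multiCircuit hm U₁ U₂ U₃ U₄ lam θ₁ θ₂) = multiControlledMultiTarget n m
      (fun j => rotX (-θ₁ j) * rotZ (-θ₂ j) * rotX (lam j) * rotZ (θ₂ j) * rotX (θ₁ j)) := by
  have honc : ∀ A B : Op (Fin n), onControls A * onControls B = onControls (A * B) := by
    intro A B; rw [onControls_eq, onControls_eq, onControls_eq, ctl_mul]
  have e₁ := eval_fanned hm U₁ C₁ (V₁ * Matrix.diagonal δ₁) 1 (by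
    rw [hU₁, ← honc, onControls_eq (1 : Op (Fin n)), ctl_one, Matrix.mul_one, Matrix.mul_assoc])
  have e₂ := eval_fanned hm U₂ C₂ (V₂ * Matrix.diagonal δ₂) V₁ᴴ (by
    rw [hU₂, ← honc]; simp only [Matrix.mul_assoc])
  have e₃ := eval_fanned hm U₃ C₁ (V₃ * (Matrix.diagonal δ₁)ᴴ) V₂ᴴ (by
    rw [hU₃, ← honc]; simp only [Matrix.mul_assoc])
  have e₄ := eval_fanned hm U₄ C₂ (Matrix.diagonal δ₂)ᴴ V₃ᴴ hU₄
  rw [← ctl_mul, Matrix.mul_assoc (ctl _) (ctl _)] at e₂ e₃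
  rw [← ctl_mul, ctl_one, Matrix.mul_one, Matrix.mul_assoc] at e₁
  rw [← macro_identity hC hδ₁ hδ₂ (conjTranspose_mul_of_mem h₁) (conjTranspose_mul_of_mem h₂)
    (conjTranspose_mul_of_mem h₃) e₁ e₂ e₃ e₄]
  have hx : ∀ f : Fin m → ℝ, eval ((List.finRange m).map
      (fun j => (Gate.Rx (f j) (Sum.inr j) : Gate (Fin n ⊕ Fin m)))) =
      pop (fun _ j => rotX (f j)) := fun f => eval_layer _ _ (fun _ => rfl)
  have hz : ∀ f : Fin m → ℝ, eval ((List.finRange m).map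
      (fun j => (Gate.Rz (f j) (Sum.inr j) : Gate (Fin n ⊕ Fin m)))) =
      pop (fun _ j => rotZ (f j)) := fun f => eval_layer _ _ (fun _ => rfl)
  simp only [multiCircuit, eval_append, hx, hz]
  rw [← pop_mul (fun _ j => rotX (-θ₁ j) * rotZ (-θ₂ j)), ← pop_mul (fun _ j => rotX (-θ₁ j)),
    ← pop_mul (fun _ j => rotZ (θ₂ j))]
  simp only [Matrix.mul_assoc]

end FanOut

/-! ### The single-target circuit -/

section SingleTarget

variable {n : ℕ}

/-- The block of the macro structure that applies a relative phase and a `Z` on the target,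
controlled by `cs`. The target is the bottom qubit of the ladder. -/
def block (b : Bool) (cs as : List (Fin n)) : Circuit (Fin n ⊕ Fin 1) :=
  ladder b (Sum.inr 0) (cs.map Sum.inl) (as.map Sum.inl)

theorem block_nodup {cs as : List (Fin n)} (h : (cs ++ as).Nodup) :
    ((Sum.inr 0 : Fin n ⊕ Fin 1) :: (cs.map Sum.inl ++ as.map Sum.inl)).Nodup := by
  rw [List.nodup_cons, ← List.map_append]
  exact ⟨by simp, h.map Sum.inl_injective⟩

/-- As the relative phase of a ladder does not depend on its bottom qubit, it is an operator on the
controls. -/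
theorem eval_block {cs as : List (Fin n)} (hlen : cs.length = as.length + 2)
    (hnd : (cs ++ as).Nodup) :
    ∃ δ : (Fin n → Fin 2) → ℂ, (∀ x, ‖δ x‖ = 1) ∧
      eval (block true cs as) = onControls (Matrix.diagonal δ) * mcz cs.toFinset ∧
      eval (block false cs as) = onControls (Matrix.diagonal δ)ᴴ * mcz cs.toFinset := by
  obtain ⟨δ, hδ, hn, hE⟩ := eval_ladder (as.map Sum.inl) (Sum.inr 0 : Fin n ⊕ Fin 1)
    (cs.map Sum.inl) (by simpa using hlen) (block_nodup hnd)
  have hδ' : ∀ x, δ x = δ (Sum.elim (x ∘ Sum.inl) (fun _ => 0)) := fun x => hδ _ _ (by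
    intro q hq
    rw [← List.map_append, List.mem_map] at hq
    obtain ⟨i, -, rfl⟩ := hq
    rfl)
  have hsgn : ∀ x : Fin n ⊕ Fin 1 → Fin 2,
      (if x (Sum.inr 0) = 1 ∧ ∀ c ∈ cs.map Sum.inl, x c = 1 then (-1 : ℂ) else 1) =
      if x (Sum.inr 0) = 1 ∧ ∀ c ∈ cs.toFinset.map Function.Embedding.inl, x c = 1 then -1
      else 1 := by
    intro x; simp
  refine ⟨fun c => δ (Sum.elim c (fun _ => 0)), fun x => hn _, ?_, ?_⟩
  · rw [block, hE true, onControls_eq, ctl_diagonal, mcz, controlled_pauliZ,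
      Matrix.diagonal_mul_diagonal]
    congr 1
    funext x
    exact congrArg₂ (· * ·) (hδ' x) (by convert hsgn x)
  · rw [block, hE false, onControls_eq, Matrix.diagonal_conjTranspose, ctl_diagonal, mcz,
      controlled_pauliZ, Matrix.diagonal_mul_diagonal]
    congr 1
    funext x
    exact congrArg₂ (· * ·) (congrArg star (hδ' x))
      (by convert hsgn x)

theorem mcz_eq_multiZ (C : Finset (Fin n)) : mcz C = multiZ C := by
  rw [mcz, controlled_inr, multiZ]
  congr 1
  funext c j
  rw [Subsingleton.elim j 0, Function.update_self]

theorem controlled_eq_pop (M : Matrix (Fin 2) (Fin 2) ℂ) :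
    (controlled ∅ (Sum.inr 0) M : Op (Fin n ⊕ Fin 1)) = pop (fun _ _ => M) := by
  rw [controlled_inr_one]
  congr 1
  funext c j
  rw [Subsingleton.elim j 0, Function.update_self]

theorem eval_macroCircuit {C₁ C₂ : Finset (Fin n)} (hC : C₁ ∪ C₂ = Finset.univ)
    {δ₁ δ₂ : (Fin n → Fin 2) → ℂ} (hδ₁ : ∀ x, ‖δ₁ x‖ = 1) (hδ₂ : ∀ x, ‖δ₂ x‖ = 1)
    {U₁ U₂ U₃ U₄ : Circuit (Fin n ⊕ Fin 1)}
    (hU₁ : eval U₁ = onControls (Matrix.diagonal δ₁) * mcz C₁)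
    (hU₂ : eval U₂ = onControls (Matrix.diagonal δ₂) * mcz C₂)
    (hU₃ : eval U₃ = onControls (Matrix.diagonal δ₁)ᴴ * mcz C₁)
    (hU₄ : eval U₄ = onControls (Matrix.diagonal δ₂)ᴴ * mcz C₂) (lam θ₁ θ₂ : ℝ) :
    eval (macroCircuit U₁ U₂ U₃ U₄ lam θ₁ θ₂) = multiControlledMultiTarget n 1
      (fun _ => rotX (-θ₁) * rotZ (-θ₂) * rotX lam * rotZ θ₂ * rotX θ₁) := by
  rw [onControls_eq, mcz_eq_multiZ] at hU₁ hU₂ hU₃ hU₄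
  have h1 : (1 : Op (Fin n))ᴴ * 1 = 1 := by simp
  rw [← macro_identity (m := 1) hC hδ₁ hδ₂ h1 h1 h1 (B₁ := eval U₁) (B₂ := eval U₂)
    (B₃ := eval U₃) (B₄ := eval U₄) (by simp [hU₁, ctl_one]) (by simp [hU₂, ctl_one])
    (by rw [hU₃, Matrix.conjTranspose_one, ctl_one, Matrix.one_mul, Matrix.mul_one])
    (by rw [hU₄, Matrix.conjTranspose_one, ctl_one, Matrix.mul_one])
    (fun _ => lam) (fun _ => θ₁) (fun _ => θ₂)]
  simp only [macroCircuit, eval_append, eval, Gate.toOp, controlled_eq_pop, Matrix.one_mul]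
  rw [← pop_mul (fun _ _ => rotX (-θ₁) * rotZ (-θ₂)), ← pop_mul (fun _ _ => rotX (-θ₁)),
    ← pop_mul (fun _ _ => rotZ θ₂)]
  simp only [Matrix.mul_assoc]

theorem count_block (k : Kind) (b : Bool) {cs as : List (Fin n)}
    (hlen : cs.length = as.length + 2) (hnd : (cs ++ as).Nodup) :
    count k (block b cs as) =
      2 * as.length * (3 * wt k .cnot + 4 * wt k .t + 2 * wt k .h) +
        (4 * wt k .cnot + 4 * wt k .t) := by
  rw [block, count_ladder k b _ _ _ (by simpa using hlen) (block_nodup hnd), List.length_map]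

theorem count_macroCircuit (k : Kind) (U₁ U₂ U₃ U₄ : Circuit (Fin n ⊕ Fin 1)) (lam θ₁ θ₂ : ℝ) :
    count k (macroCircuit U₁ U₂ U₃ U₄ lam θ₁ θ₂) =
      count k U₁ + count k U₂ + count k U₃ + count k U₄ + 8 * wt k .rot := by
  simp only [macroCircuit, count_append, count_cons, count_nil, Gate.kind]
  ring

/-- Consecutive blocks start with disjoint pairs of outermost qubits, so that each of them can start
before the previous one is finished. -/
theorem depth_macroCircuit_block {k : Kind} (hk : k ≠ .rot) {f D K : ℕ}
    (hf : f = wt k .h + 2 * wt k .t + wt k .cnot) (hD : D = wt k .cnot + f)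
    (hK : K = 4 * wt k .cnot + 4 * wt k .t) {cs₁ as₁ cs₂ as₂ : List (Fin n)}
    (hlen₁ : cs₁.length = as₁.length + 2) (hnd₁ : (cs₁ ++ as₁).Nodup)
    (hlen₂ : cs₂.length = as₂.length + 2) (hnd₂ : (cs₂ ++ as₂).Nodup)
    (hdisj : ∀ i ∈ cs₁.take 1 ++ as₁.take 1, i ∉ cs₂.take 1 ++ as₂.take 1) (lam θ₁ θ₂ : ℝ) :
    depth k (macroCircuit (block true cs₁ as₁) (block true cs₂ as₂) (block false cs₁ as₁)
      (block false cs₂ as₂) lam θ₁ θ₂) ≤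
      5 * f + 4 * (as₁.length + as₂.length) * D + 4 * K := by
  have hd : ∀ l l' : List (Fin n), (∀ i ∈ l, i ∉ l') →
      ∀ q ∈ l.map (Sum.inl : Fin n → Fin n ⊕ Fin 1), q ∉ l'.map Sum.inl := by
    intro l l' h q hq hq'
    rw [List.mem_map] at hq hq'
    obtain ⟨i, hi, rfl⟩ := hq
    obtain ⟨j, hj, e⟩ := hq'
    rw [Sum.inl_injective e] at hj
    exact h i hi hj
  have step := fun (b : Bool) (cs as : List (Fin n)) (hlen : cs.length = as.length + 2)
      (hnd : (cs ++ as).Nodup) (lev : Fin n ⊕ Fin 1 → ℕ) (p : ℕ) (E : List (Fin n))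
      (h1 : ∀ q, lev q ≤ p + f) (h2 : ∀ q ∉ E.map Sum.inl, lev q ≤ p)
      (hE : ∀ i ∈ cs.take 1 ++ as.take 1, i ∉ E) =>
    levels_ladder_of_late k b hf hD hK (Sum.inr 0) (cs.map Sum.inl) (as.map Sum.inl) lev p
      (by simpa using hlen) (block_nodup hnd) (E.map Sum.inl) h1 h2 (by
        rw [← List.map_take, ← List.map_take, ← List.map_append]
        exact hd _ _ hE)
  simp only [← List.map_take, ← List.map_append, List.length_map] at step
  obtain ⟨a1, b1⟩ := step true cs₁ as₁ hlen₁ hnd₁ (fun _ => 0) 0 [] (fun _ => Nat.zero_le _)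
    (fun _ _ => le_rfl) (fun _ _ => List.not_mem_nil)
  obtain ⟨a2, b2⟩ := step true cs₂ as₂ hlen₂ hnd₂ _ _ _ a1 b1 (fun i hi hi' => hdisj i hi' hi)
  obtain ⟨a3, b3⟩ := step false cs₁ as₁ hlen₁ hnd₁ _ _ _ a2 b2 hdisj
  obtain ⟨a4, -⟩ := step false cs₂ as₂ hlen₂ hnd₂ _ _ _ a3 b3 (fun i hi hi' => hdisj i hi' hi)
  refine Finset.sup_le fun q _ => ?_
  have hl := congrFun (levels_macroCircuit hk (block true cs₁ as₁) (block true cs₂ as₂)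
    (block false cs₁ as₁) (block false cs₂ as₂) lam θ₁ θ₂ (fun _ => 0)) q
  have h4 := a4 q
  change levels k _ (fun _ => 0) q ≤ _
  rw [hl]
  refine h4.trans (le_of_eq ?_)
  ring

/-- The controls, split into two halves of at least two qubits. -/
theorem exists_halves (hn : 6 ≤ n) : ∃ (c c' d d' : Fin n) (l₁ l₂ : List (Fin n)),
    (c :: c' :: l₁ ++ d :: d' :: l₂).Nodup ∧ (∀ i, i ∈ c :: c' :: l₁ ++ d :: d' :: l₂) ∧
    l₁.length + l₂.length + 4 = n ∧ l₁.length ≤ l₂.length + 1 ∧ l₂.length ≤ l₁.length + 1 := by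
  have hl : (List.finRange n).length = n := List.length_finRange
  have h1 : ((List.finRange n).take ((n + 1) / 2)).length = (n + 1) / 2 := by
    rw [List.length_take, hl]; omega
  have h2 : ((List.finRange n).drop ((n + 1) / 2)).length = n - (n + 1) / 2 := by
    rw [List.length_drop, hl]
  have happ := List.take_append_drop ((n + 1) / 2) (List.finRange n)
  generalize (List.finRange n).take ((n + 1) / 2) = L₁ at h1 happ
  generalize (List.finRange n).drop ((n + 1) / 2) = L₂ at h2 happ
  match L₁, L₂, h1, h2, happ with
  | [], _, h1, _, _ => simp at h1; omega
  | [_], _, h1, _, _ => simp at h1; omega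
  | _ :: _ :: _, [], _, h2, _ => simp at h2; omega
  | _ :: _ :: _, [_], _, h2, _ => simp at h2; omega
  | c :: c' :: l₁, d :: d' :: l₂, h1, h2, happ =>
    simp only [List.length_cons] at h1 h2
    refine ⟨c, c', d, d', l₁, l₂, ?_, ?_, by omega, by omega, by omega⟩
    · rw [happ]; exact List.nodup_finRange n
    · rw [happ]; exact List.mem_finRange

theorem mem_take_take {α : Type*} {a q : α} {l : List α} {r : ℕ}
    (h : q ∈ ((a :: l).take r).take 1) : q = a := by
  cases r with
  | zero => simp at h
  | succ r => simpa using h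

/-- A macro implementation without anything moved between its blocks. The number `n - 4` is the
total number of ancillas of the two kinds of blocks. -/
theorem exists_macroImplementation (hn : 6 ≤ n) (W : Matrix (Fin 2) (Fin 2) ℂ)
    (hW : W ∈ Matrix.specialUnitaryGroup (Fin 2) ℂ) :
    ∃ K : Circuit (Fin n ⊕ Fin 1), IsMacroImplementation K W ∧
      (∀ k, count k K = 4 * (n - 4) * (3 * wt k .cnot + 4 * wt k .t + 2 * wt k .h) +
        4 * (4 * wt k .cnot + 4 * wt k .t) + 8 * wt k .rot) ∧
      ∀ k, k ≠ .rot → depth k K ≤ 5 * (wt k .h + 2 * wt k .t + wt k .cnot) +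
        4 * (n - 4) * (wt k .cnot + (wt k .h + 2 * wt k .t + wt k .cnot)) +
        4 * (4 * wt k .cnot + 4 * wt k .t) := by
  obtain ⟨lam, θ₁, θ₂, hrot⟩ := exists_euler W hW
  obtain ⟨c, c', d, d', l₁, l₂, hnd, hcov, hlen, hle₁, hle₂⟩ := exists_halves hn
  -- Each half without its first qubit provides the ancillas for the other half. So the outermost
  -- qubits of the two kinds of blocks are `c, d'` and `d, c'`.
  set as₁ := (d' :: l₂).take l₁.length with has₁
  set as₂ := (c' :: l₁).take l₂.length with has₂
  have ha₁ : as₁.length = l₁.length := by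
    rw [has₁, List.length_take, List.length_cons]; omega
  have ha₂ : as₂.length = l₂.length := by
    rw [has₂, List.length_take, List.length_cons]; omega
  have hlen₁ : (c :: c' :: l₁).length = as₁.length + 2 := by rw [ha₁]; rfl
  have hlen₂ : (d :: d' :: l₂).length = as₂.length + 2 := by rw [ha₂]; rfl
  have hnd₁ : (c :: c' :: l₁ ++ as₁).Nodup :=
    (((List.take_sublist _ _).cons d).append_left _).nodup hnd
  have hnd₂ : (d :: d' :: l₂ ++ as₂).Nodup :=
    (((List.take_sublist _ _).cons c).append_left _).nodup (List.nodup_append_comm.1 hnd)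
  have hdisj : ∀ i ∈ (c :: c' :: l₁).take 1 ++ as₁.take 1,
      i ∉ (d :: d' :: l₂).take 1 ++ as₂.take 1 := by
    intro i hi hi'
    have h1 : i = c ∨ i = d' := (List.mem_append.1 hi).imp (by simp) mem_take_take
    have h2 : i = d ∨ i = c' := (List.mem_append.1 hi').imp (by simp) mem_take_take
    simp only [List.cons_append, List.nodup_cons, List.mem_cons, List.mem_append, not_or,
      List.nodup_append] at hnd
    rcases h1 with rfl | rfl <;> rcases h2 with rfl | rfl <;> simp_all
  obtain ⟨δ₁, hδ₁, hU₁, hU₃⟩ := eval_block hlen₁ hnd₁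
  obtain ⟨δ₂, hδ₂, hU₂, hU₄⟩ := eval_block hlen₂ hnd₂
  have hC : (c :: c' :: l₁).toFinset ∪ (d :: d' :: l₂).toFinset = Finset.univ := by
    ext i
    have := hcov i
    simp at this ⊢
    tauto
  have honc : (onControls (1 : Op (Fin n))) = 1 := by rw [onControls_eq, ctl_one]
  refine ⟨macroCircuit (block true (c :: c' :: l₁) as₁) (block true (d :: d' :: l₂) as₂)
    (block false (c :: c' :: l₁) as₁) (block false (d :: d' :: l₂) as₂) lam θ₁ θ₂,
    ⟨_, _, δ₁, δ₂, 1, 1, 1, _, _, _, _, lam, θ₁, θ₂, hC, hδ₁, hδ₂, one_mem _, one_mem _, one_mem _,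
      ?_, ?_, ?_, ?_, rfl, ?_⟩, ?_, ?_⟩
  · rw [hU₁, honc, Matrix.one_mul]
  · rw [hU₂, Matrix.conjTranspose_one, honc, Matrix.one_mul, Matrix.mul_one]
  · rw [hU₃, Matrix.conjTranspose_one, honc, Matrix.one_mul, Matrix.mul_one]
  · rw [hU₄, Matrix.conjTranspose_one, honc, Matrix.mul_one]
  · rw [eval_macroCircuit hC hδ₁ hδ₂ hU₁ hU₂ hU₃ hU₄, ← hrot]
  · intro k
    have e : n - 4 = l₁.length + l₂.length := by omega
    rw [count_macroCircuit, count_block k _ hlen₁ hnd₁, count_block k _ hlen₁ hnd₁,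
      count_block k _ hlen₂ hnd₂, count_block k _ hlen₂ hnd₂, ha₁, ha₂, e]
    ring
  · intro k hk
    have e : n - 4 = as₁.length + as₂.length := by omega
    rw [e]
    exact depth_macroCircuit_block hk rfl rfl rfl hlen₁ hnd₁ hlen₂ hnd₂ hdisj lam θ₁ θ₂

end SingleTarget

end QCircuit

theorem mainTheorem7 (n m : ℕ) (hn : 6 ≤ n) (hm : 1 ≤ m) :
    -- every single-target gate has a macro implementation with the following costs and depths
    (∀ W ∈ Matrix.specialUnitaryGroup (Fin 2) ℂ,
      ∃ K : QCircuit.Circuit (Fin n ⊕ Fin 1),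
        QCircuit.IsMacroImplementation K W ∧
        QCircuit.count .rot K = 8 ∧
        QCircuit.count .cnot K + 32 = 12 * n ∧
        QCircuit.count .t K + 48 = 16 * n ∧
        QCircuit.count .h K + 32 = 8 * n ∧
        QCircuit.depth .cnot K + 8 ≤ 8 * n ∧
        QCircuit.depth .t K + (if Even n then 6 else 3) ≤ 8 * n ∧
        QCircuit.depth .h K + 11 ≤ 4 * n) ∧
    -- every multi-target gate has the costs and depths of any such implementation of a
    -- single-target gate, up to the stated increases
    (∀ W₀ ∈ Matrix.specialUnitaryGroup (Fin 2) ℂ,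
      ∀ K : QCircuit.Circuit (Fin n ⊕ Fin 1), QCircuit.IsMacroImplementation K W₀ →
      ∀ W : Fin m → Matrix (Fin 2) (Fin 2) ℂ,
        (∀ j, W j ∈ Matrix.specialUnitaryGroup (Fin 2) ℂ) →
        ∃ c : QCircuit.Circuit (Fin n ⊕ Fin m),
          QCircuit.eval c = QCircuit.multiControlledMultiTarget n m W ∧
          QCircuit.count .rot c = QCircuit.count .rot K + 8 * (m - 1) ∧
          QCircuit.count .cnot c = QCircuit.count .cnot K + 8 * (m - 1) ∧
          QCircuit.count .t c = QCircuit.count .t K ∧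
          QCircuit.count .h c = QCircuit.count .h K ∧
          QCircuit.depth .cnot c ≤ QCircuit.depth .cnot K + 8 * Nat.clog 2 m ∧
          QCircuit.depth .t c ≤ QCircuit.depth .t K ∧
          QCircuit.depth .h c ≤ QCircuit.depth .h K) := by
  constructor
  · intro W hW
    obtain ⟨K, hK, hcount, hdepth⟩ := QCircuit.exists_macroImplementation hn W hW
    have h1 := hcount .rot
    have h2 := hcount .cnot
    have h3 := hcount .t
    have h4 := hcount .h
    have h5 := hdepth .cnot (by simp)
    have h6 := hdepth .t (by simp)
    have h7 := hdepth .h (by simp)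
    simp only [QCircuit.wt, reduceCtorEq, if_true, if_false] at h1 h2 h3 h4 h5 h6 h7
    refine ⟨K, hK, by omega, by omega, by omega, by omega, by omega, ?_, by omega⟩
    split_ifs <;> omega
  · rintro W₀ - K ⟨C₁, C₂, δ₁, δ₂, V₁, V₂, V₃, U₁, U₂, U₃, U₄, lam, θ₁, θ₂, hC, hδ₁, hδ₂, hV₁, hV₂,
      hV₃, hU₁, hU₂, hU₃, hU₄, rfl, -⟩ W hW
    choose lam' θ₁' θ₂' hrot using fun j => QCircuit.exists_euler (W j) (hW j)
    have hcount := fun k => QCircuit.count_multiCircuit hm k U₁ U₂ U₃ U₄ lam' θ₁' θ₂' lam θ₁ θ₂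
    have hdepth := fun k (hk : k ≠ QCircuit.Kind.rot) =>
      QCircuit.depth_multiCircuit hm hk U₁ U₂ U₃ U₄ lam' θ₁' θ₂' lam θ₁ θ₂
    have h1 := hcount .rot
    have h2 := hcount .cnot
    have h3 := hcount .t
    have h4 := hcount .h
    have h5 := hdepth .cnot (by simp)
    have h6 := hdepth .t (by simp)
    have h7 := hdepth .h (by simp)
    simp only [QCircuit.wt, reduceCtorEq, if_true, if_false, mul_zero, mul_one, add_zero]
      at h1 h2 h3 h4 h5 h6 h7
    refine ⟨QCircuit.multiCircuit hm U₁ U₂ U₃ U₄ lam' θ₁' θ₂', ?_, h1, h2, h3, h4, h5, h6, h7⟩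
    rw [QCircuit.eval_multiCircuit hm hC hδ₁ hδ₂ hV₁ hV₂ hV₃ hU₁ hU₂ hU₃ hU₄]
    congr 1
    funext j
    exact (hrot j).symm
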